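/- Let $$C = 1-\int_0^1\Big(\frac{1}{t(e^t-1)}-\frac1{t^2}+\frac1{2t}\Big)dt-\int_1^\infty\frac{dt}{t(e^t-1)} .$$ Both integrals converge absolutely and $C=\tfrac12(\log 2\pi-\gamma)$, where $\gamma$ is Euler's constant. For all integers $m,n\ge 1$ (coprime or not), the integral below converges absolutely and $$mn\int_0^\infty\Big(\frac1{mt}-\frac1{e^{mt}-1}\Big)\Big(\frac1{nt}-\frac1{e^{nt}-1}\Big)dt = -\frac12+C(n+m)+\frac{m-n}{2}\log\frac nm-\frac\pi2\sum_{k=1}^{n-1}\frac{mk}{n}\cot\Big(\frac{mk\pi}{n}\Big)-\frac\pi2\sum_{l=1}^{m-1}\frac{nl}{m}\cot\Big(\frac{nl\pi}{m}\Big),$$ with the following convention for the undefined cotangents (those whose argument is an integer multiple of $\pi$): whenever $1\le k\le n-1$ and $1\le l\le m-1$ satisfy $k/l=n/m$, one sets $$\cot\Big(\frac{mk\pi}{n}\Big)\frac{mk\pi}{n}+\cot\Big(\frac{nl\pi}{m}\Big)\frac{nl\pi}{m}=1 .$$ That is, the formula holds for every assignment of real values to the undefined cotangents that satisfies these relations,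 and such an assignment exists. Moreover, the value $1$ is the limiting value: for such $k,l$, $$\lim_{x\to m/n,\ x\ne m/n}\Big(\cot(xk\pi)\,xk\pi+\cot\big(\tfrac1x\,l\pi\big)\tfrac1x\,l\pi\Big)=1 .$$ -/

import Mathlib

open MeasureTheory Set Filter Topology

noncomputable section

/-- The function `t ↦ 1 / (n t) - 1 / (e ^ (n t) - 1)`, considered for `t > 0`. -/
def vasyuninE (n : ℕ) (t : ℝ) : ℝ :=
  1 / ((n : ℝ) * t) - 1 / (Real.exp ((n : ℝ) * t) - 1)

/-- The integrand of the first integral in the definition of the constant `C`. -/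
def constIntegrandZero (t : ℝ) : ℝ :=
  1 / (t * (Real.exp t - 1)) - 1 / t ^ 2 + 1 / (2 * t)

/-- The integrand of the second integral in the definition of the constant `C`. -/
def constIntegrandInf (t : ℝ) : ℝ :=
  1 / (t * (Real.exp t - 1))

/-- The constant `C`, defined through integrals. -/
def vasyuninC : ℝ :=
  1 - (∫ t in (0 : ℝ)..1, constIntegrandZero t) - ∫ t in Ioi (1 : ℝ), constIntegrandInf t

/-- `c k` and `d l` are admissible values of the symbols `cot (m k π / n)`, `1 ≤ k ≤ n - 1`, and
`cot (n l π / m)`, `1 ≤ l ≤ m - 1`: they are the true cotangents wherever the cotangent is defined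
(that is, unless the argument is an integer multiple of `π`), and the undefined ones obey the
convention that `cot (m k π / n) * (m k π / n) + cot (n l π / m) * (n l π / m)` is `1`
whenever `k / l = n / m`. -/
structure IsCotConvention (m n : ℕ) (c d : ℕ → ℝ) : Prop where
  left_eq : ∀ k ∈ Finset.Ico 1 n, ¬ n ∣ m * k →
    c k = Real.cot ((m : ℝ) * k * Real.pi / n)
  right_eq : ∀ l ∈ Finset.Ico 1 m, ¬ m ∣ n * l →
    d l = Real.cot ((n : ℝ) * l * Real.pi / m)
  pair_eq : ∀ k ∈ Finset.Ico 1 n, ∀ l ∈ Finset.Ico 1 m, (k : ℝ) / l = (n : ℝ) / m →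
    c k * ((m : ℝ) * k * Real.pi / n) + d l * ((n : ℝ) * l * Real.pi / m) = 1

end

/-! For coprime m and n the product coth(mt/2) coth(nt/2) has only simple poles modulo 2πi, apart
from a double pole at t = 0. Its partial fractions follow from the addition formula for coth summed
over pairs of roots of unity (`halfCoth_pow_mul_halfCoth_pow`). On the real line the simple poles
give cotangents times `sinKernel`. That kernel has integral π/2 - φ, and since the cotangents sum to
zero only the weighted cotangent sums survive (`integral_cotKernelSum`).

What remains is elementary except for terms (n/t)/(e^(nt) - 1). Adding n² `bernoulliMoment` (nt)
makes each of these elementary too, and the integral of `bernoulliMoment` is 1 - C: by elementary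
antiderivatives from the definition of C, and by a geometric series, the harmonic numbers and
Stirling from its closed form. The limit of `productPrimitive` at 0 supplies the logarithm and the
constant.

For gcd g, scaling t multiplies the coprime formula by g, so -1/2 becomes -g/2. `Real.cot` is 0 at
its poles; replacing these zeros by values obeying the convention adds one unit for each of the g -
1 pairs, which restores -1/2. -/

noncomputable section

/-! ### Partial fractions for products of hyperbolic cotangents. -/

/-- The Cayley-type transform `z ↦ (z + 1) / (2 (z - 1))`, so that
`halfCoth (e ^ t) = coth (t / 2) / 2`. It takes the value `0` at `z = 1`. -/
def halfCoth (z : ℂ) : ℂ := (z + 1) / (2 * (z - 1))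

lemma halfCoth_one : halfCoth 1 = 0 := by simp [halfCoth]

lemma halfCoth_eq {z : ℂ} (hz : z ≠ 1) : halfCoth z = 1 / 2 + 1 / (z - 1) := by
  have : z - 1 ≠ 0 := sub_ne_zero.2 hz
  unfold halfCoth
  field_simp
  ring

lemma halfCoth_inv {z : ℂ} (h0 : z ≠ 0) : halfCoth z⁻¹ = -halfCoth z := by
  rcases eq_or_ne z 1 with rfl | h1
  · simp [halfCoth]
  have h2 : z - 1 ≠ 0 := sub_ne_zero.2 h1
  have h3 : 1 - z ≠ 0 := sub_ne_zero.2 h1.symm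
  have h4 : z⁻¹ - 1 = (1 - z) / z := by field_simp
  unfold halfCoth
  rw [h4]
  field_simp
  ring

/-- The addition formula coth a coth b = 1 + coth(a - b)(coth b - coth a) in exponential
coordinates. -/
lemma halfCoth_mul {x y : ℂ} (hx : x ≠ 1) (hy : y ≠ 1) (hy0 : y ≠ 0) (hxy : x ≠ y) :
    halfCoth x * halfCoth y = 1 / 4 + halfCoth (x / y) * (halfCoth y - halfCoth x) := by
  have h1 : x - 1 ≠ 0 := sub_ne_zero.2 hx
  have h2 : y - 1 ≠ 0 := sub_ne_zero.2 hy
  have h3 : x - y ≠ 0 := sub_ne_zero.2 hxy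
  have h4 : x / y - 1 = (x - y) / y := by field_simp
  unfold halfCoth
  rw [h4]
  field_simp
  ring

lemma IsPrimitiveRoot.sum_range_pow_pow {n : ℕ} {ζ : ℂ} (hζ : IsPrimitiveRoot ζ n) {r : ℕ}
    (hr0 : r ≠ 0) (hr : r < n) : ∑ j ∈ Finset.range n, (ζ ^ j) ^ r = 0 := by
  have h1 : ζ ^ r ≠ 1 := hζ.pow_ne_one_of_pos_of_lt hr0 hr
  have h2 : ∑ j ∈ Finset.range n, (ζ ^ r) ^ j = ((ζ ^ r) ^ n - 1) / (ζ ^ r - 1) :=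
    geom_sum_eq h1 n
  rw [← pow_mul, mul_comm r n, pow_mul, hζ.pow_eq_one, one_pow, sub_self, zero_div] at h2
  rw [← h2]
  exact Finset.sum_congr rfl fun j _ => by rw [← pow_mul, ← pow_mul, mul_comm]

/-- Distribution relation for coth: writing 1/(z - 1) as a geometric sum over z^n - 1, orthogonality
of the roots of unity keeps only the power r = 0. -/
lemma sum_halfCoth_mul_pow {n : ℕ} (hn : n ≠ 0) {ζ : ℂ} (hζ : IsPrimitiveRoot ζ n) {w : ℂ}
    (hw : w ^ n ≠ 1) : ∑ j ∈ Finset.range n, halfCoth (w * ζ ^ j) = n * halfCoth (w ^ n) := by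
  have hw' : w ^ n - 1 ≠ 0 := sub_ne_zero.2 hw
  have hp : ∀ j, (w * ζ ^ j) ^ n = w ^ n := fun j => by
    rw [mul_pow, ← pow_mul, mul_comm j n, pow_mul, hζ.pow_eq_one, one_pow, mul_one]
  have h1 : ∀ j, w * ζ ^ j ≠ 1 := fun j h => hw (by rw [← hp j, h, one_pow])
  have h2 : ∀ j, halfCoth (w * ζ ^ j) =
      1 / 2 + (∑ r ∈ Finset.range n, w ^ r * (ζ ^ j) ^ r) / (w ^ n - 1) := fun j => by
    have hg := geom_sum_eq (h1 j) n
    rw [hp] at hg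
    simp only [mul_pow] at hg
    rw [halfCoth_eq (h1 j), hg]
    have : w * ζ ^ j - 1 ≠ 0 := sub_ne_zero.2 (h1 j)
    field_simp
  have h3 : ∑ j ∈ Finset.range n, ∑ r ∈ Finset.range n, w ^ r * (ζ ^ j) ^ r = n := by
    rw [Finset.sum_comm, Finset.sum_eq_single 0]
    · simp
    · intro r hr hr0
      rw [← Finset.mul_sum, hζ.sum_range_pow_pow hr0 (Finset.mem_range.1 hr), mul_zero]
    · intro h
      exact absurd (Finset.mem_range.2 (Nat.pos_of_ne_zero hn)) h
  rw [Finset.sum_congr rfl fun j _ => h2 j, Finset.sum_add_distrib, ← Finset.sum_div _ _ (w ^ n - 1),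
    h3, halfCoth_eq hw, Finset.sum_const, Finset.card_range, nsmul_eq_mul]
  ring

lemma IsPrimitiveRoot.sum_range_comp_inv {n : ℕ} (hn : n ≠ 0) {ζ : ℂ} (hζ : IsPrimitiveRoot ζ n)
    (F : ℂ → ℂ) :
    ∑ j ∈ Finset.range n, F (ζ ^ j)⁻¹ = ∑ j ∈ Finset.range n, F (ζ ^ j) := by
  obtain ⟨k, rfl⟩ := Nat.exists_eq_succ_of_ne_zero hn
  rw [Finset.sum_range_succ', Finset.sum_range_succ', ← Finset.sum_range_reflect]
  simp only [pow_zero, inv_one]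
  congr 1
  refine Finset.sum_congr rfl fun j hj => ?_
  have hj := Finset.mem_range.1 hj
  congr 1
  apply inv_eq_of_mul_eq_one_left
  rw [← pow_add, show j + 1 + (k - 1 - j + 1) = k.succ by omega, hζ.pow_eq_one]

lemma sum_halfCoth_pow {n : ℕ} (hn : n ≠ 0) {ζ : ℂ} (hζ : IsPrimitiveRoot ζ n) :
    ∑ j ∈ Finset.range n, halfCoth (ζ ^ j) = 0 := by
  have h := hζ.sum_range_comp_inv hn halfCoth
  simp only [halfCoth_inv (pow_ne_zero _ (hζ.ne_zero hn)), Finset.sum_neg_distrib] at h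
  exact self_eq_neg.1 h.symm

/-- The pole w = 1 is allowed: both sides then vanish, because `halfCoth` is odd with value 0 at 1.
Coprimality will supply the hypothesis. -/
lemma sum_halfCoth_div_pow {n : ℕ} (hn : n ≠ 0) {ζ : ℂ} (hζ : IsPrimitiveRoot ζ n) {w : ℂ}
    (hw : w ^ n = 1 → w = 1) :
    ∑ j ∈ Finset.range n, halfCoth (w / ζ ^ j) = n * halfCoth (w ^ n) := by
  simp only [div_eq_mul_inv]
  rw [hζ.sum_range_comp_inv hn (fun z => halfCoth (w * z))]
  by_cases h : w ^ n = 1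
  · simp [hw h, halfCoth_one, sum_halfCoth_pow hn hζ]
  · exact sum_halfCoth_mul_pow hn hζ h

/-- Partial fraction expansion of a product of two hyperbolic cotangents with coprime
frequencies. -/
lemma halfCoth_pow_mul_halfCoth_pow {m n : ℕ} (hm : m ≠ 0) (hn : n ≠ 0) (hmn : m.Coprime n)
    {η ζ w : ℂ} (hη : IsPrimitiveRoot η m) (hζ : IsPrimitiveRoot ζ n) (hw0 : w ≠ 0)
    (hwm : w ^ m ≠ 1) (hwn : w ^ n ≠ 1) :
    halfCoth (w ^ m) * halfCoth (w ^ n) = 1 / 4 + (halfCoth w ^ 2 - 1 / 4) / (m * n)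
      - 1 / n * ∑ j ∈ Finset.range n, halfCoth (ζ ^ (m * j)) * halfCoth (w * ζ ^ j)
      - 1 / m * ∑ l ∈ Finset.range m, halfCoth (η ^ (n * l)) * halfCoth (w * η ^ l) := by
  have hη0 : ∀ l, η ^ l ≠ 0 := fun l => pow_ne_zero _ (hη.ne_zero hm)
  have hζ0 : ∀ j, ζ ^ j ≠ 0 := fun j => pow_ne_zero _ (hζ.ne_zero hn)
  have hηp : ∀ l, (η ^ l) ^ m = 1 := fun l => by
    rw [← pow_mul, mul_comm, pow_mul, hη.pow_eq_one, one_pow]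
  have hζp : ∀ j, (ζ ^ j) ^ n = 1 := fun j => by
    rw [← pow_mul, mul_comm, pow_mul, hζ.pow_eq_one, one_pow]
  have hcop : ∀ z : ℂ, z ^ m = 1 → z ^ n = 1 → z = 1 := fun z h1 h2 => by
    have h3 : orderOf z ∣ Nat.gcd m n :=
      Nat.dvd_gcd (orderOf_dvd_of_pow_eq_one h1) (orderOf_dvd_of_pow_eq_one h2)
    rw [hmn] at h3
    exact orderOf_eq_one_iff.1 (Nat.dvd_one.1 h3)
  have hm' : (m : ℂ) ≠ 0 := Nat.cast_ne_zero.2 hm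
  have hn' : (n : ℂ) ≠ 0 := Nat.cast_ne_zero.2 hn
  have hx : ∀ j, w * ζ ^ j ≠ 1 := fun j h => hwn (by
    have := congrArg (· ^ n) h
    simpa [mul_pow, hζp] using this)
  have hy : ∀ l, w * η ^ l ≠ 1 := fun l h => hwm (by
    have := congrArg (· ^ m) h
    simpa [mul_pow, hηp] using this)
  -- The addition formula applies to every pair except j = l = 0, the only coincidence of an n-th
  -- and an m-th root of unity; that pair produces the double pole.
  have hprod : ∀ j ∈ Finset.range n, ∀ l ∈ Finset.range m,
      halfCoth (w * η ^ l) * halfCoth (w * ζ ^ j) = 1 / 4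
        + (if j = 0 then (if l = 0 then halfCoth w ^ 2 - 1 / 4 else 0) else 0)
        - halfCoth (ζ ^ j / η ^ l) * halfCoth (w * ζ ^ j)
        - halfCoth (η ^ l / ζ ^ j) * halfCoth (w * η ^ l) := by
    intro j hj l hl
    have hj := Finset.mem_range.1 hj
    have hl := Finset.mem_range.1 hl
    have hinv : halfCoth (η ^ l / ζ ^ j) = -halfCoth (ζ ^ j / η ^ l) := by
      rw [← halfCoth_inv (div_ne_zero (hζ0 j) (hη0 l)), inv_div]
    by_cases hjl : j = 0 ∧ l = 0
    · obtain ⟨rfl, rfl⟩ := hjl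
      simp [halfCoth_one]
      ring
    · have hne : ζ ^ j ≠ η ^ l := fun h => by
        have h1 : ζ ^ j = 1 := hcop _ (by rw [h, hηp]) (hζp j)
        have h2 : η ^ l = 1 := by rw [← h, h1]
        have h3 : j = 0 := Nat.eq_zero_of_dvd_of_lt (hζ.dvd_of_pow_eq_one _ h1) hj
        have h4 : l = 0 := Nat.eq_zero_of_dvd_of_lt (hη.dvd_of_pow_eq_one _ h2) hl
        exact hjl ⟨h3, h4⟩
      have hif : (if j = 0 then (if l = 0 then halfCoth w ^ 2 - 1 / 4 else 0) else 0) = 0 := by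
        split_ifs with h1 h2
        · exact absurd ⟨h1, h2⟩ hjl
        · rfl
        · rfl
      rw [hif, mul_comm, halfCoth_mul (hx j) (hy l) (mul_ne_zero hw0 (hη0 l))
        (fun h => hne (mul_left_cancel₀ hw0 h)), mul_div_mul_left _ _ hw0, hinv]
      ring
  have hA : ∀ j, ∑ l ∈ Finset.range m, halfCoth (ζ ^ j / η ^ l) = m * halfCoth (ζ ^ (m * j)) :=
    fun j => by
      rw [sum_halfCoth_div_pow hm hη (fun h => hcop _ h (hζp j)), ← pow_mul, mul_comm j m]
  have hB : ∀ l, ∑ j ∈ Finset.range n, halfCoth (η ^ l / ζ ^ j) = n * halfCoth (η ^ (n * l)) :=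
    fun l => by
      rw [sum_halfCoth_div_pow hn hζ (fun h => hcop _ (hηp l) h), ← pow_mul, mul_comm l n]
  -- Multiply the two distribution relations, expand the double sum by `hprod`, and collapse each
  -- inner sum by `hA` or `hB`.
  have hsum : (m * halfCoth (w ^ m)) * (n * halfCoth (w ^ n)) =
      m * n * (1 / 4) + (halfCoth w ^ 2 - 1 / 4)
      - m * ∑ j ∈ Finset.range n, halfCoth (ζ ^ (m * j)) * halfCoth (w * ζ ^ j)
      - n * ∑ l ∈ Finset.range m, halfCoth (η ^ (n * l)) * halfCoth (w * η ^ l) := by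
    rw [← sum_halfCoth_mul_pow hm hη hwm, ← sum_halfCoth_mul_pow hn hζ hwn, Finset.sum_mul_sum,
      Finset.sum_comm, Finset.sum_congr rfl fun j hj => Finset.sum_congr rfl (hprod j hj)]
    simp only [Finset.sum_sub_distrib, Finset.sum_add_distrib]
    congr 1
    · congr 1
      · congr 1
        · simp
          ring
        · simp [Finset.sum_ite_eq', hm, hn, Nat.pos_of_ne_zero]
      · simp only [← Finset.sum_mul, hA, Finset.mul_sum, mul_assoc]
    · rw [Finset.sum_comm]
      simp only [← Finset.sum_mul, hB, Finset.mul_sum, mul_assoc]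
  field_simp
  linear_combination 4 * hsum

/-! ### The expansion in real form. -/

lemma halfCoth_exp_real {t : ℝ} (ht : t ≠ 0) :
    halfCoth (Real.exp t : ℂ) = ((1 / (Real.exp t - 1) + 1 / 2 : ℝ) : ℂ) := by
  have h : (Real.exp t : ℂ) ≠ 1 := by
    rw [← Complex.ofReal_one, Ne, Complex.ofReal_inj, Real.exp_eq_one_iff]
    exact ht
  rw [halfCoth_eq h]
  push_cast
  ring

/-- Also valid at the poles, where both sides take the default value 0. -/
lemma halfCoth_exp_mul_I (θ : ℝ) :
    halfCoth (Complex.exp (θ * Complex.I)) = -(Complex.I / 2) * (Real.cot (θ / 2) : ℝ) := by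
  rw [Complex.ofReal_cot, Complex.cot_eq_exp_ratio]
  push_cast
  rw [show 2 * Complex.I * ((θ : ℂ) / 2) = θ * Complex.I by ring]
  set z := Complex.exp (θ * Complex.I)
  unfold halfCoth
  rcases eq_or_ne z 1 with h | h
  · simp [h]
  · have h1 : z - 1 ≠ 0 := sub_ne_zero.2 h
    have h2 : 1 - z ≠ 0 := sub_ne_zero.2 h.symm
    have h3 := Complex.I_ne_zero
    field_simp
    ring

/-- The function `t ↦ sin θ / (2 (cosh t - cos θ))`. -/
def sinKernel (θ t : ℝ) : ℝ :=
  Real.exp t * Real.sin θ / (Real.exp t ^ 2 - 2 * Real.exp t * Real.cos θ + 1)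

lemma halfCoth_exp_mul_exp_im {t : ℝ} (ht : t ≠ 0) (θ : ℝ) :
    (halfCoth (Real.exp t * Complex.exp (θ * Complex.I))).im = -sinKernel θ t := by
  set w := Real.exp t
  have hre : ((w : ℂ) * Complex.exp (θ * Complex.I)).re = w * Real.cos θ := by
    rw [Complex.re_ofReal_mul, Complex.exp_ofReal_mul_I_re]
  have him : ((w : ℂ) * Complex.exp (θ * Complex.I)).im = w * Real.sin θ := by
    rw [Complex.im_ofReal_mul, Complex.exp_ofReal_mul_I_im]
  have hne : (w : ℂ) * Complex.exp (θ * Complex.I) ≠ 1 := fun h => by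
    have := congrArg norm h
    rw [norm_mul, Complex.norm_exp_ofReal_mul_I, Complex.norm_real, mul_one, norm_one,
      Real.norm_of_nonneg (Real.exp_pos t).le, Real.exp_eq_one_iff] at this
    exact ht this
  rw [halfCoth_eq hne, Complex.add_im, show ((1 : ℂ) / 2).im = 0 by simp, zero_add, one_div,
    Complex.inv_im, Complex.sub_im, him,
    Complex.normSq_apply, Complex.sub_re, Complex.sub_im, hre, him]
  have hden : (w * Real.cos θ - 1) * (w * Real.cos θ - 1) + w * Real.sin θ * (w * Real.sin θ) =
      w ^ 2 - 2 * w * Real.cos θ + 1 := by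
    linear_combination w ^ 2 * Real.sin_sq_add_cos_sq θ
  simp only [Complex.one_re, Complex.one_im, sub_zero, hden]
  rw [neg_div, sinKernel]

lemma exp_nat_pow_eq (n k j : ℕ) :
    Complex.exp (2 * Real.pi * Complex.I / n) ^ (k * j) =
      Complex.exp ((2 * (k * j * Real.pi / n) : ℝ) * Complex.I) := by
  rw [← Complex.exp_nat_mul]
  congr 1
  push_cast
  ring

/-- Partial fraction expansion of a product of two hyperbolic cotangents with coprime
frequencies, in real form. -/
lemma coth_mul_coth_eq {m n : ℕ} (hm : m ≠ 0) (hn : n ≠ 0) (hmn : m.Coprime n) {t : ℝ}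
    (ht : 0 < t) :
    (1 / (Real.exp (m * t) - 1) + 1 / 2) * (1 / (Real.exp (n * t) - 1) + 1 / 2) =
      1 / 4 + Real.exp t / (Real.exp t - 1) ^ 2 / (m * n)
      + 1 / (2 * n) * ∑ k ∈ Finset.range n,
          Real.cot (m * k * Real.pi / n) * sinKernel (2 * (k * Real.pi / n)) t
      + 1 / (2 * m) * ∑ l ∈ Finset.range m,
          Real.cot (n * l * Real.pi / m) * sinKernel (2 * (l * Real.pi / m)) t := by
  have hm' : (m : ℝ) ≠ 0 := Nat.cast_ne_zero.2 hm
  have hn' : (n : ℝ) ≠ 0 := Nat.cast_ne_zero.2 hn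
  have hpow : ∀ p : ℕ, (Real.exp t : ℂ) ^ p = (Real.exp (p * t) : ℂ) := fun p => by
    rw [← Complex.ofReal_pow, Real.exp_nat_mul]
  have hne : ∀ p : ℕ, p ≠ 0 → (Real.exp t : ℂ) ^ p ≠ 1 := fun p hp h => by
    rw [hpow, ← Complex.ofReal_one, Complex.ofReal_inj, Real.exp_eq_one_iff] at h
    exact mul_ne_zero (Nat.cast_ne_zero.2 hp) ht.ne' h
  have key := halfCoth_pow_mul_halfCoth_pow hm hn hmn (Complex.isPrimitiveRoot_exp m hm)
    (Complex.isPrimitiveRoot_exp n hn) (Complex.ofReal_ne_zero.2 (Real.exp_ne_zero t))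
    (hne m hm) (hne n hn)
  -- The coefficient is purely imaginary, so the real part sees only the imaginary part of the other
  -- factor, which is -`sinKernel`.
  have hterm : ∀ p q : ℕ, (1 / (p : ℂ) * ∑ j ∈ Finset.range p,
      halfCoth (Complex.exp (2 * Real.pi * Complex.I / p) ^ (q * j)) *
        halfCoth (Real.exp t * Complex.exp (2 * Real.pi * Complex.I / p) ^ j)).re =
      -(1 / (2 * p) * ∑ j ∈ Finset.range p,
          Real.cot (q * j * Real.pi / p) * sinKernel (2 * (j * Real.pi / p)) t) := fun p q => by
    rw [show (1 / (p : ℂ)) = ((1 / p : ℝ) : ℂ) by push_cast; rfl, Complex.re_ofReal_mul,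
      Complex.re_sum, Finset.mul_sum, Finset.mul_sum, ← Finset.sum_neg_distrib]
    refine Finset.sum_congr rfl fun j _ => ?_
    have h1 := exp_nat_pow_eq p 1 j
    rw [one_mul, Nat.cast_one, one_mul] at h1
    rw [exp_nat_pow_eq, halfCoth_exp_mul_I, mul_div_cancel_left₀ _ (two_ne_zero' ℝ), h1,
      Complex.mul_re, halfCoth_exp_mul_exp_im ht.ne']
    generalize Real.cot _ = c
    simp
    ring
  have hre := congrArg Complex.re key
  rw [Complex.sub_re, Complex.sub_re, hterm, hterm, hpow, hpow,
    halfCoth_exp_real (mul_ne_zero hm' ht.ne'), halfCoth_exp_real (mul_ne_zero hn' ht.ne'),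
    halfCoth_exp_real ht.ne', ← Complex.ofReal_mul, Complex.ofReal_re] at hre
  rw [hre, sub_neg_eq_add, sub_neg_eq_add]
  have h1 : Real.exp t - 1 ≠ 0 := sub_ne_zero.2 (Real.one_lt_exp_iff.2 ht).ne'
  have h2 : ((1 : ℂ) / 4 + (((1 / (Real.exp t - 1) + 1 / 2 : ℝ) : ℂ) ^ 2 - 1 / 4) / (m * n)).re =
      1 / 4 + ((1 / (Real.exp t - 1) + 1 / 2) ^ 2 - 1 / 4) / (m * n) := by
    rw [← Complex.ofReal_re (1 / 4 + ((1 / (Real.exp t - 1) + 1 / 2) ^ 2 - 1 / 4) / (m * n) : ℝ)]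
    push_cast
    rfl
  rw [h2]
  congr 3
  field_simp
  ring

/-! ### Integral of the sine kernel. -/

lemma integral_Ioi_of_hasDerivAt_of_tendsto_nhdsGT {f f' : ℝ → ℝ} {a l m : ℝ}
    (hderiv : ∀ x ∈ Ioi a, HasDerivAt f (f' x) x) (hint : IntegrableOn f' (Ioi a))
    (ha : Tendsto f (𝓝[>] a) (𝓝 l)) (hm : Tendsto f atTop (𝓝 m)) :
    ∫ x in Ioi a, f' x = m - l := by
  have hne : ∀ x ∈ Ioi a, Function.update f a l x = f x := fun x hx =>
    Function.update_of_ne (ne_of_gt hx) _ _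
  have h := integral_Ioi_of_hasDerivAt_of_tendsto (f := Function.update f a l) (f' := f') (m := m)
    (a := a) ?_ ?_ hint ?_
  · rwa [Function.update_self] at h
  · rw [continuousWithinAt_update_same, Ici_sdiff_left]
    exact ha
  · intro x hx
    refine (hderiv x hx).congr_of_eventuallyEq ?_
    filter_upwards [Ioi_mem_nhds hx] with y hy using hne y hy
  · refine hm.congr' ?_
    filter_upwards [Ioi_mem_atTop a] with y hy using (hne y hy).symm

lemma sinKernel_denom_pos {t : ℝ} (ht : 0 < t) (θ : ℝ) :
    0 < Real.exp t ^ 2 - 2 * Real.exp t * Real.cos θ + 1 := by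
  have h := Real.one_lt_exp_iff.2 ht
  have h2 := Real.cos_le_one θ
  nlinarith [mul_le_mul_of_nonneg_left h2 (Real.exp_pos t).le, sq_pos_of_pos (sub_pos.2 h)]

/-- The antiderivative is arctan(cot φ tanh(t/2)); the denominator of the kernel is the sum of
squares `hd`. -/
lemma hasDerivAt_arctan_sinKernel {φ t : ℝ} (hφ : Real.sin φ ≠ 0) :
    HasDerivAt (fun t => Real.arctan (Real.cot φ * ((Real.exp t - 1) / (Real.exp t + 1))))
      (sinKernel (2 * φ) t) t := by
  have hw := Real.exp_pos t
  have hw1 : Real.exp t + 1 ≠ 0 := by positivity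
  have h1 := ((((Real.hasDerivAt_exp t).sub_const 1).div ((Real.hasDerivAt_exp t).add_const 1)
    hw1).const_mul (Real.cot φ)).arctan
  convert! h1 using 1
  have hs := Real.sin_sq_add_cos_sq φ
  simp only [Pi.div_apply]
  rw [sinKernel, Real.sin_two_mul, Real.cos_two_mul, Real.cot_eq_cos_div_sin]
  have hd : Real.exp t ^ 2 - 2 * Real.exp t * (2 * Real.cos φ ^ 2 - 1) + 1 =
      Real.sin φ ^ 2 * (Real.exp t + 1) ^ 2 + Real.cos φ ^ 2 * (Real.exp t - 1) ^ 2 := by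
    rw [Real.sin_sq]
    ring
  have hd0 : 0 < Real.sin φ ^ 2 * (Real.exp t + 1) ^ 2 + Real.cos φ ^ 2 * (Real.exp t - 1) ^ 2 := by
    positivity
  have hd1 : 1 + (Real.cos φ / Real.sin φ * ((Real.exp t - 1) / (Real.exp t + 1))) ^ 2 =
      (Real.sin φ ^ 2 * (Real.exp t + 1) ^ 2 + Real.cos φ ^ 2 * (Real.exp t - 1) ^ 2) /
        (Real.sin φ ^ 2 * (Real.exp t + 1) ^ 2) := by
    field_simp
  rw [hd, hd1]
  field_simp
  ring

lemma tendsto_exp_sub_one_div_exp_add_one :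
    Tendsto (fun t : ℝ => (Real.exp t - 1) / (Real.exp t + 1)) atTop (𝓝 1) := by
  have h1 : Tendsto (fun t : ℝ => 2 / (Real.exp t + 1)) atTop (𝓝 0) :=
    tendsto_const_nhds.div_atTop (Real.tendsto_exp_atTop.atTop_add tendsto_const_nhds)
  have h2 := h1.const_sub 1
  rw [sub_zero] at h2
  refine h2.congr fun t => ?_
  have : Real.exp t + 1 ≠ 0 := by positivity
  field_simp
  ring

lemma tendsto_arctan_sinKernel {φ : ℝ} (hφ : φ ∈ Ioo 0 Real.pi) :
    Tendsto (fun t => Real.arctan (Real.cot φ * ((Real.exp t - 1) / (Real.exp t + 1)))) atTop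
      (𝓝 (Real.pi / 2 - φ)) := by
  have h : Real.arctan (Real.cot φ * 1) = Real.pi / 2 - φ := by
    rw [mul_one, ← Real.tan_inv_eq_cot, ← Real.tan_pi_div_two_sub]
    exact Real.arctan_tan (by linarith [hφ.2]) (by linarith [hφ.1])
  rw [← h]
  exact (Real.continuous_arctan.tendsto _).comp
    (tendsto_exp_sub_one_div_exp_add_one.const_mul _)

/-- For t > 0 the kernel has the constant sign of sin 2φ, so a finite limit of the antiderivative
gives integrability. -/
lemma integrableOn_sinKernel {φ : ℝ} (hφ : φ ∈ Ioo 0 Real.pi) :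
    IntegrableOn (sinKernel (2 * φ)) (Ioi 0) := by
  have hs : Real.sin φ ≠ 0 := (Real.sin_pos_of_mem_Ioo hφ).ne'
  rcases le_total 0 (Real.sin (2 * φ)) with h | h
  · refine integrableOn_Ioi_deriv_of_nonneg'
      (fun x _ => hasDerivAt_arctan_sinKernel hs) (fun x hx => ?_) (tendsto_arctan_sinKernel hφ)
    exact div_nonneg (mul_nonneg (Real.exp_pos x).le h) (sinKernel_denom_pos hx _).le
  · refine integrableOn_Ioi_deriv_of_nonpos'
      (fun x _ => hasDerivAt_arctan_sinKernel hs) (fun x hx => ?_) (tendsto_arctan_sinKernel hφ)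
    exact div_nonpos_of_nonpos_of_nonneg (mul_nonpos_of_nonneg_of_nonpos (Real.exp_pos x).le h)
      (sinKernel_denom_pos hx _).le

lemma integral_sinKernel {φ : ℝ} (hφ : φ ∈ Ioo 0 Real.pi) :
    ∫ t in Ioi 0, sinKernel (2 * φ) t = Real.pi / 2 - φ := by
  have hs : Real.sin φ ≠ 0 := (Real.sin_pos_of_mem_Ioo hφ).ne'
  rw [integral_Ioi_of_hasDerivAt_of_tendsto' (fun x _ => hasDerivAt_arctan_sinKernel hs)
    (integrableOn_sinKernel hφ) (tendsto_arctan_sinKernel hφ)]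
  simp

/-! ### The moment integral and its closed form. -/

/-- The function `t ↦ ∫ s in 0..1, s (1 - e ^ (- t s))`. -/
def expMoment (t : ℝ) : ℝ := 1 / 2 + Real.exp (-t) / t - (1 - Real.exp (-t)) / t ^ 2

lemma integral_mul_one_sub_exp {t : ℝ} (ht : t ≠ 0) :
    ∫ s in (0 : ℝ)..1, s * (1 - Real.exp (-(t * s))) = expMoment t := by
  have hd : ∀ s : ℝ, HasDerivAt
      (fun s => s ^ 2 / 2 + s * Real.exp (-(t * s)) / t + Real.exp (-(t * s)) / t ^ 2)
      (s * (1 - Real.exp (-(t * s)))) s := fun s => by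
    have he : HasDerivAt (fun s => Real.exp (-(t * s))) (Real.exp (-(t * s)) * -(t * 1)) s :=
      ((hasDerivAt_id s).const_mul t).neg.exp
    have h := ((((hasDerivAt_id s).pow 2).div_const 2).add
      (((hasDerivAt_id s).mul he).div_const t)).add (he.div_const (t ^ 2))
    convert! h using 1
    simp
    field_simp
    ring
  rw [intervalIntegral.integral_eq_sub_of_hasDerivAt (fun s _ => hd s)
    (Continuous.intervalIntegrable (by fun_prop) _ _), expMoment]
  simp
  ring

lemma expMoment_nonneg {t : ℝ} (ht : 0 < t) : 0 ≤ expMoment t := by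
  rw [← integral_mul_one_sub_exp ht.ne']
  refine intervalIntegral.integral_nonneg zero_le_one fun s hs => ?_
  exact mul_nonneg hs.1 (sub_nonneg.2 (Real.exp_le_one_iff.2
    (neg_nonpos.2 (mul_nonneg ht.le hs.1))))

lemma integrable_exp_mul_kernel {p : ℝ} (hp : 0 < p) :
    Integrable (Function.uncurry fun t s : ℝ =>
      Real.exp (-p * t) * (s * (1 - Real.exp (-(t * s)))))
      ((volume.restrict (Ioi 0)).prod (volume.restrict (Ioc 0 1))) := by
  have h1 : Integrable (fun t : ℝ => Real.exp (-p * t)) (volume.restrict (Ioi 0)) :=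
    integrableOn_exp_mul_Ioi (neg_neg_of_pos hp) 0
  refine (h1.comp_fst (volume.restrict (Ioc (0 : ℝ) 1))).mono'
    (Continuous.aestronglyMeasurable (by fun_prop)) ?_
  rw [Measure.prod_restrict, ae_restrict_iff' (measurableSet_Ioi.prod measurableSet_Ioc)]
  refine Eventually.of_forall fun z hz => ?_
  obtain ⟨hz1, hz2, hz3⟩ := hz
  have hts : 0 ≤ z.1 * z.2 := mul_nonneg (le_of_lt hz1) hz2.le
  have h2 : Real.exp (-(z.1 * z.2)) ≤ 1 := Real.exp_le_one_iff.2 (neg_nonpos.2 hts)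
  have h3 := Real.exp_pos (-(z.1 * z.2))
  have h4 : 0 ≤ z.2 * (1 - Real.exp (-(z.1 * z.2))) := mul_nonneg hz2.le (by linarith)
  have h5 : z.2 * (1 - Real.exp (-(z.1 * z.2))) ≤ 1 :=
    mul_le_one₀ hz3 (by linarith) (by linarith)
  simp only [Function.uncurry]
  rw [Real.norm_of_nonneg (mul_nonneg (Real.exp_pos _).le h4)]
  exact mul_le_of_le_one_right (Real.exp_pos _).le h5

lemma integral_exp_mul_kernel_right {p t : ℝ} (ht : 0 < t) :
    ∫ s in Ioc (0 : ℝ) 1, Real.exp (-p * t) * (s * (1 - Real.exp (-(t * s)))) =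
      Real.exp (-p * t) * expMoment t := by
  rw [integral_const_mul, ← intervalIntegral.integral_of_le zero_le_one,
    integral_mul_one_sub_exp ht.ne']

lemma integral_exp_mul_kernel_left {p s : ℝ} (hp : 0 < p) (hs : 0 < s) :
    ∫ t in Ioi (0 : ℝ), Real.exp (-p * t) * (s * (1 - Real.exp (-(t * s)))) =
      s / p - s / (p + s) := by
  have hps : 0 < p + s := by positivity
  have h : ∀ t : ℝ, Real.exp (-p * t) * (s * (1 - Real.exp (-(t * s)))) =
      s * Real.exp (-p * t) - s * Real.exp (-(p + s) * t) := fun t => by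
    rw [show -(p + s) * t = -p * t + -(t * s) by ring, Real.exp_add]
    ring
  simp only [h]
  rw [integral_sub ((integrableOn_exp_mul_Ioi (neg_neg_of_pos hp) 0).const_mul s)
    ((integrableOn_exp_mul_Ioi (neg_neg_of_pos hps) 0).const_mul s), integral_const_mul,
    integral_const_mul, integral_exp_mul_Ioi (neg_neg_of_pos hp),
    integral_exp_mul_Ioi (neg_neg_of_pos hps), mul_zero, mul_zero, Real.exp_zero, neg_div_neg_eq,
    neg_div_neg_eq]
  ring

lemma integral_div_sub_div {p : ℝ} (hp : 0 < p) :
    ∫ s in Ioc (0 : ℝ) 1, (s / p - s / (p + s)) =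
      1 / (2 * p) - 1 + p * (Real.log (p + 1) - Real.log p) := by
  rw [← intervalIntegral.integral_of_le zero_le_one]
  have hpos : ∀ s ∈ uIcc (0 : ℝ) 1, p + s ≠ 0 := fun s hs => by
    rw [uIcc_of_le zero_le_one] at hs
    linarith [hs.1]
  have hd : ∀ s ∈ uIcc (0 : ℝ) 1, HasDerivAt
      (fun s => s ^ 2 / 2 / p - s + p * Real.log (p + s)) (s / p - s / (p + s)) s := fun s hs => by
    have h := (((((hasDerivAt_id s).pow 2).div_const 2).div_const p).sub (hasDerivAt_id s)).add
      ((((hasDerivAt_id s).const_add p).log (hpos s hs)).const_mul p)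
    convert! h using 1
    have := hpos s hs
    simp
    field_simp
    ring
  rw [intervalIntegral.integral_eq_sub_of_hasDerivAt hd
    (ContinuousOn.intervalIntegrable (by fun_prop (disch := assumption)))]
  simp
  field_simp
  ring

lemma integrableOn_exp_mul_expMoment {p : ℝ} (hp : 0 < p) :
    IntegrableOn (fun t => Real.exp (-p * t) * expMoment t) (Ioi 0) :=
  (integrable_exp_mul_kernel hp).integral_prod_left.congr
    ((ae_restrict_iff' measurableSet_Ioi).2 (Eventually.of_forall fun _ ht =>
      integral_exp_mul_kernel_right ht))

/-- Fubini: the t-integral first is an elementary Laplace transform, and the s-integral then yields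
the logarithm. -/
lemma integral_exp_mul_expMoment {p : ℝ} (hp : 0 < p) :
    ∫ t in Ioi (0 : ℝ), Real.exp (-p * t) * expMoment t =
      1 / (2 * p) - 1 + p * (Real.log (p + 1) - Real.log p) := by
  rw [← integral_div_sub_div hp, ← setIntegral_congr_fun measurableSet_Ioi
    fun t ht => integral_exp_mul_kernel_right (p := p) ht,
    integral_integral_swap (integrable_exp_mul_kernel hp)]
  exact setIntegral_congr_fun measurableSet_Ioc fun s hs => integral_exp_mul_kernel_left hp hs.1

lemma sum_range_log_moment (N : ℕ) :
    ∑ k ∈ Finset.range N, (1 / (2 * ((k : ℝ) + 1)) - 1 +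
        ((k : ℝ) + 1) * (Real.log ((k : ℝ) + 1 + 1) - Real.log ((k : ℝ) + 1))) =
      1 / 2 * (harmonic N : ℝ) - N + N * Real.log (N + 1) - Real.log N.factorial := by
  induction N with
  | zero => simp
  | succ N ih =>
    have h1 : (N : ℝ) + 1 ≠ 0 := by positivity
    rw [Finset.sum_range_succ, ih, harmonic_succ, Nat.factorial_succ]
    push_cast
    rw [Real.log_mul h1 (Nat.cast_ne_zero.2 N.factorial_ne_zero)]
    field_simp
    ring

/-- The partial sums equal (H_N - log N)/2 + N log(1 + 1/N) - log `stirlingSeq` N - (log 2)/2, with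
limits γ/2, 1 and log √π for the first three expressions. -/
lemma hasSum_log_moment :
    HasSum (fun k : ℕ => 1 / (2 * ((k : ℝ) + 1)) - 1 +
        ((k : ℝ) + 1) * (Real.log ((k : ℝ) + 1 + 1) - Real.log ((k : ℝ) + 1)))
      (1 - 1 / 2 * (Real.log (2 * Real.pi) - Real.eulerMascheroniConstant)) := by
  have hnn : ∀ k : ℕ, 0 ≤ 1 / (2 * ((k : ℝ) + 1)) - 1 +
      ((k : ℝ) + 1) * (Real.log ((k : ℝ) + 1 + 1) - Real.log ((k : ℝ) + 1)) := fun k => by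
    rw [← integral_exp_mul_expMoment (by positivity : 0 < (k : ℝ) + 1)]
    exact setIntegral_nonneg measurableSet_Ioi fun t ht =>
      mul_nonneg (Real.exp_pos _).le (expMoment_nonneg ht)
  rw [hasSum_iff_tendsto_nat_of_nonneg hnn]
  simp only [sum_range_log_moment]
  have h1 := Real.tendsto_harmonic_sub_log.const_mul (1 / 2)
  have h2 := Real.tendsto_mul_log_one_add_div_atTop 1 |>.comp tendsto_natCast_atTop_atTop
  have h3 := ((Real.continuousAt_log (Real.sqrt_ne_zero'.2 Real.pi_pos)).tendsto.comp
    Stirling.tendsto_stirlingSeq_sqrt_pi)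
  have h4 := ((h1.add h2).sub h3).sub_const (1 / 2 * Real.log 2)
  refine (h4.congr' ?_).trans (le_of_eq ?_)
  · filter_upwards [eventually_gt_atTop 0] with N hN
    have hN' : (0 : ℝ) < N := Nat.cast_pos.2 hN
    simp only [Function.comp]
    rw [Stirling.log_stirlingSeq_formula, Real.log_mul two_ne_zero hN'.ne',
      Real.log_div hN'.ne' (Real.exp_ne_zero 1), Real.log_exp,
      show 1 + 1 / (N : ℝ) = (N + 1) / N by field_simp,
      Real.log_div (by positivity) hN'.ne']
    ring
  · congr 1
    rw [Real.log_sqrt Real.pi_pos.le, Real.log_mul two_ne_zero Real.pi_ne_zero]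
    ring

/-- The product of `1 / (e ^ t - 1)` and `expMoment t`. -/
def bernoulliMoment (t : ℝ) : ℝ := 1 / (Real.exp t - 1) * expMoment t

lemma hasSum_exp_mul_expMoment {t : ℝ} (ht : 0 < t) :
    HasSum (fun k : ℕ => Real.exp (-((k : ℝ) + 1) * t) * expMoment t) (bernoulliMoment t) := by
  refine HasSum.mul_right _ ?_
  have h := (hasSum_geometric_of_lt_one (Real.exp_pos (-t)).le
    (Real.exp_lt_one_iff.2 (neg_neg_of_pos ht))).mul_left (Real.exp (-t))
  have he := (Real.one_lt_exp_iff.2 ht)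
  have h2 : Real.exp (-t) * (1 - Real.exp (-t))⁻¹ = 1 / (Real.exp t - 1) := by
    have h3 : Real.exp t - 1 ≠ 0 := by linarith
    rw [Real.exp_neg, show 1 - (Real.exp t)⁻¹ = (Real.exp t - 1) / Real.exp t by
      field_simp]
    field_simp
  rw [h2] at h
  refine h.congr_fun fun k => ?_
  rw [← Real.exp_nat_mul, ← Real.exp_add]
  congr 1
  ring

/-- Expand 1/(e^t - 1) as a geometric series; nonnegative terms with summable integrals permit
termwise integration. -/
lemma integral_bernoulliMoment :
    ∫ t in Ioi (0 : ℝ), bernoulliMoment t =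
      1 - 1 / 2 * (Real.log (2 * Real.pi) - Real.eulerMascheroniConstant) := by
  have hp : ∀ k : ℕ, (0 : ℝ) < (k : ℝ) + 1 := fun k => by positivity
  have hn : ∀ k : ℕ, ∫ t in Ioi (0 : ℝ), ‖Real.exp (-((k : ℝ) + 1) * t) * expMoment t‖ =
      ∫ t in Ioi (0 : ℝ), Real.exp (-((k : ℝ) + 1) * t) * expMoment t := fun k =>
    setIntegral_congr_fun measurableSet_Ioi fun t ht =>
      Real.norm_of_nonneg (mul_nonneg (Real.exp_pos _).le (expMoment_nonneg ht))
  have h := hasSum_integral_of_summable_integral_norm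
    (F := fun (k : ℕ) t => Real.exp (-((k : ℝ) + 1) * t) * expMoment t)
    (fun k => integrableOn_exp_mul_expMoment (hp k))
    (by simpa only [hn, integral_exp_mul_expMoment (hp _)] using hasSum_log_moment.summable)
  simp only [integral_exp_mul_expMoment (hp _)] at h
  rw [← h.unique hasSum_log_moment]
  exact setIntegral_congr_fun measurableSet_Ioi fun t ht =>
    (hasSum_exp_mul_expMoment ht).tsum_eq.symm

lemma integrableOn_bernoulliMoment : IntegrableOn bernoulliMoment (Ioi 0) := by
  -- A non-integrable function has integral 0 by default. Here the integral is at least the k = 0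
  -- term log 2 - 1/2 > 0.
  refine Integrable.of_integral_ne_zero ?_
  rw [integral_bernoulliMoment]
  have h := le_hasSum hasSum_log_moment 0 fun k _ => by
    rw [← integral_exp_mul_expMoment (by positivity : 0 < (k : ℝ) + 1)]
    exact setIntegral_nonneg measurableSet_Ioi fun t ht =>
      mul_nonneg (Real.exp_pos _).le (expMoment_nonneg ht)
  refine (lt_of_lt_of_le ?_ h).ne'
  have h2 := Real.log_two_gt_d9
  norm_num
  linarith

/-! ### The moment integral equals 1 - C. -/

lemma exp_neg_lt_one {t : ℝ} (ht : 0 < t) : Real.exp (-t) < 1 :=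
  Real.exp_lt_one_iff.2 (neg_neg_of_pos ht)

lemma hasDerivAt_log_one_sub_exp_neg {t : ℝ} (ht : 0 < t) :
    HasDerivAt (fun t => Real.log (1 - Real.exp (-t))) (1 / (Real.exp t - 1)) t := by
  have h1 : 1 - Real.exp (-t) ≠ 0 := (sub_pos.2 (exp_neg_lt_one ht)).ne'
  have h2 : Real.exp t - 1 ≠ 0 := (sub_pos.2 (Real.one_lt_exp_iff.2 ht)).ne'
  have h := ((hasDerivAt_neg t).exp.const_sub 1).log h1
  convert! h using 1
  have h3 : Real.exp (-t) * Real.exp t = 1 := by rw [← Real.exp_add]; simp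
  field_simp
  linear_combination -h3

/-- The elementary function `t ↦ - e ^ (-t) / t - log (1 - e ^ (-t)) / 2`. -/
def boseLog (t : ℝ) : ℝ := -(Real.exp (-t) / t) - 1 / 2 * Real.log (1 - Real.exp (-t))

/-- Since (1 - e^(-t))/(e^t - 1) = e^(-t), the difference is e^(-t)/t + e^(-t)/t² - 1/(2(e^t - 1)),
which is elementary. -/
lemma hasDerivAt_boseLog {t : ℝ} (ht : 0 < t) :
    HasDerivAt boseLog (constIntegrandInf t - bernoulliMoment t) t := by
  have h := ((hasDerivAt_neg t).exp.div (hasDerivAt_id t) ht.ne').neg.sub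
    ((hasDerivAt_log_one_sub_exp_neg ht).const_mul (1 / 2))
  convert! h using 1
  have h2 : Real.exp t - 1 ≠ 0 := (sub_pos.2 (Real.one_lt_exp_iff.2 ht)).ne'
  simp only [constIntegrandInf, bernoulliMoment, expMoment, Real.exp_neg, id]
  field_simp
  ring

/-- The function `boseLog` without its singular part at `0`. -/
def boseLogReg (t : ℝ) : ℝ := boseLog t + 1 / t + 1 / 2 * Real.log t

lemma hasDerivAt_boseLogReg {t : ℝ} (ht : 0 < t) :
    HasDerivAt boseLogReg (constIntegrandZero t - bernoulliMoment t) t := by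
  have h := ((hasDerivAt_boseLog ht).add (hasDerivAt_inv ht.ne')).add
    ((Real.hasDerivAt_log ht.ne').const_mul (1 / 2))
  convert! h using 1
  · ext x
    simp [boseLogReg]
  · simp only [constIntegrandInf, constIntegrandZero]
    field_simp
    ring

lemma tendsto_one_sub_exp_neg_div :
    Tendsto (fun t : ℝ => (1 - Real.exp (-t)) / t) (𝓝[>] 0) (𝓝 1) := by
  have h := ((hasDerivAt_neg (0 : ℝ)).exp.const_sub 1).tendsto_slope_zero_right
  simp only [zero_add, neg_zero, Real.exp_zero, sub_self, sub_zero, smul_eq_mul] at h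
  norm_num at h
  exact h.congr fun t => by rw [div_eq_inv_mul]

lemma tendsto_log_one_sub_exp_neg_div :
    Tendsto (fun t : ℝ => Real.log ((1 - Real.exp (-t)) / t)) (𝓝[>] 0) (𝓝 0) := by
  have h := (Real.continuousAt_log one_ne_zero).tendsto.comp tendsto_one_sub_exp_neg_div
  rwa [Real.log_one] at h

lemma boseLogReg_eq {t : ℝ} (ht : 0 < t) :
    boseLogReg t = (1 - Real.exp (-t)) / t - 1 / 2 * Real.log ((1 - Real.exp (-t)) / t) := by
  rw [boseLogReg, boseLog, Real.log_div (sub_pos.2 (exp_neg_lt_one ht)).ne' ht.ne']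
  ring

lemma tendsto_boseLogReg : Tendsto boseLogReg (𝓝[>] 0) (𝓝 1) := by
  have h := tendsto_one_sub_exp_neg_div.sub (tendsto_log_one_sub_exp_neg_div.const_mul (1 / 2))
  rw [mul_zero, sub_zero] at h
  refine h.congr' ?_
  filter_upwards [self_mem_nhdsWithin] with t ht using (boseLogReg_eq ht).symm

lemma tendsto_log_one_sub_exp_neg_atTop :
    Tendsto (fun t : ℝ => Real.log (1 - Real.exp (-t))) atTop (𝓝 0) := by
  have h : Tendsto (fun t : ℝ => 1 - Real.exp (-t)) atTop (𝓝 1) := by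
    simpa using Real.tendsto_exp_neg_atTop_nhds_zero.const_sub 1
  rw [← Real.log_one]
  exact (Real.continuousAt_log one_ne_zero).tendsto.comp h

lemma tendsto_boseLog_atTop : Tendsto boseLog atTop (𝓝 0) := by
  have h := (Real.tendsto_exp_neg_atTop_nhds_zero.mul tendsto_inv_atTop_zero).neg.sub
    (tendsto_log_one_sub_exp_neg_atTop.const_mul (1 / 2))
  unfold boseLog
  simpa [div_eq_mul_inv] using! h

lemma vasyuninE_eq_comp (n : ℕ) (t : ℝ) : vasyuninE n t = vasyuninE 1 (n * t) := by
  simp [vasyuninE]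

lemma vasyuninE_one_nonneg {t : ℝ} (ht : 0 < t) : 0 ≤ vasyuninE 1 t := by
  have h := Real.add_one_le_exp t
  rw [vasyuninE, Nat.cast_one, one_mul, sub_nonneg]
  exact one_div_le_one_div_of_le ht (by linarith)

lemma vasyuninE_one_le_inv {t : ℝ} (ht : 0 < t) : vasyuninE 1 t ≤ 1 / t := by
  have h := Real.one_lt_exp_iff.2 ht
  rw [vasyuninE, Nat.cast_one, one_mul]
  exact sub_le_self _ (one_div_nonneg.2 (by linarith))

lemma vasyuninE_one_le_one {t : ℝ} (ht : 0 < t) : vasyuninE 1 t ≤ 1 := by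
  have h := Real.one_lt_exp_iff.2 ht
  have h1 : Real.exp t - 1 ≠ 0 := by linarith
  have h2 := Real.add_one_le_exp (-t)
  have h3 : Real.exp (-t) * Real.exp t = 1 := by rw [← Real.exp_add]; simp
  rw [vasyuninE, Nat.cast_one, one_mul, div_sub_div _ _ ht.ne' h1,
    div_le_one (mul_pos ht (by linarith))]
  nlinarith [mul_le_mul_of_nonneg_right h2 (Real.exp_pos t).le]

lemma tendsto_vasyuninE_one : Tendsto (vasyuninE 1) (𝓝[>] 0) (𝓝 (1 / 2)) := by
  have h1 : Tendsto (fun t : ℝ => (Real.exp t - 1) / t) (𝓝[>] 0) (𝓝 1) := by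
    have h := (Real.hasDerivAt_exp 0).tendsto_slope_zero_right
    simp only [zero_add, Real.exp_zero, smul_eq_mul] at h
    exact h.congr fun t => by rw [div_eq_inv_mul]
  have h2 : Tendsto (fun t : ℝ => (Real.exp t - 1 - t) / t ^ 2) (𝓝[>] 0) (𝓝 (1 / 2)) := by
    refine HasDerivAt.lhopital_zero_nhdsGT (f' := fun t => Real.exp t - 1)
      (g' := fun t => 2 * t) ?_ ?_ ?_ ?_ ?_ ?_
    · exact Eventually.of_forall fun t =>
        ((Real.hasDerivAt_exp t).sub_const 1).sub (hasDerivAt_id t)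
    · exact Eventually.of_forall fun t => by simpa using hasDerivAt_pow 2 t
    · filter_upwards [self_mem_nhdsWithin] with t ht using (mul_pos two_pos ht).ne'
    · refine tendsto_nhdsWithin_of_tendsto_nhds (Continuous.tendsto' ?_ _ _ ?_)
      · fun_prop
      · simp
    · refine tendsto_nhdsWithin_of_tendsto_nhds (Continuous.tendsto' ?_ _ _ ?_)
      · fun_prop
      · simp
    · refine (h1.div_const 2).congr fun t => ?_
      rw [div_div, mul_comm]
  have h3 := h2.div h1 one_ne_zero
  rw [div_one] at h3
  refine h3.congr' ?_
  filter_upwards [self_mem_nhdsWithin] with t (ht : 0 < t)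
  have h : Real.exp t - 1 ≠ 0 := (sub_pos.2 (Real.one_lt_exp_iff.2 ht)).ne'
  simp only [Pi.div_apply, vasyuninE, Nat.cast_one, one_mul]
  field_simp

lemma integrableOn_constIntegrandInf : IntegrableOn constIntegrandInf (Ioi 1) := by
  refine ((integrableOn_exp_mul_Ioi (neg_neg_of_pos one_pos) 1).const_mul 2).mono' ?_ ?_
  · unfold constIntegrandInf
    exact Measurable.aestronglyMeasurable (by fun_prop)
  · refine (ae_restrict_iff' measurableSet_Ioi).2 (Eventually.of_forall fun t (ht : 1 < t) => ?_)
    have h := Real.add_one_le_exp t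
    have h1 : 0 < Real.exp t - 1 := by linarith
    have h2 : 0 < t * (Real.exp t - 1) := by positivity
    rw [constIntegrandInf, Real.norm_of_nonneg (by positivity), neg_one_mul, Real.exp_neg,
      ← div_eq_mul_inv, div_le_div_iff₀ h2 (Real.exp_pos t)]
    nlinarith

/-- The singularities at 0 cancel, leaving two bounded terms. -/
lemma constIntegrandZero_sub_bernoulliMoment {t : ℝ} (ht : 0 < t) :
    constIntegrandZero t - bernoulliMoment t =
      1 / 2 * vasyuninE 1 t - (1 - Real.exp (-t) - t * Real.exp (-t)) / t ^ 2 := by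
  have h2 : Real.exp t - 1 ≠ 0 := (sub_pos.2 (Real.one_lt_exp_iff.2 ht)).ne'
  simp only [constIntegrandZero, bernoulliMoment, expMoment, vasyuninE, Real.exp_neg, Nat.cast_one,
    one_mul]
  field_simp
  ring

lemma abs_constIntegrandZero_sub_bernoulliMoment_le {t : ℝ} (ht : 0 < t) :
    |constIntegrandZero t - bernoulliMoment t| ≤ 2 := by
  have h1 := Real.add_one_le_exp t
  have h2 := Real.add_one_le_exp (-t)
  have h3 : Real.exp (-t) * Real.exp t = 1 := by rw [← Real.exp_add]; simp
  have h4 : 0 ≤ 1 - Real.exp (-t) - t * Real.exp (-t) := by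
    nlinarith [mul_le_mul_of_nonneg_left h1 (Real.exp_pos (-t)).le]
  have h5 : 1 - Real.exp (-t) - t * Real.exp (-t) ≤ t ^ 2 := by
    nlinarith [mul_le_mul_of_nonneg_left h2 (by linarith : 0 ≤ 1 + t)]
  have h6 : (1 - Real.exp (-t) - t * Real.exp (-t)) / t ^ 2 ≤ 1 :=
    (div_le_one (by positivity)).2 h5
  have h7 : 0 ≤ (1 - Real.exp (-t) - t * Real.exp (-t)) / t ^ 2 := by positivity
  rw [constIntegrandZero_sub_bernoulliMoment ht, abs_le]
  constructor <;> linarith [vasyuninE_one_nonneg ht, vasyuninE_one_le_one ht]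

lemma intervalIntegrable_bernoulliMoment : IntervalIntegrable bernoulliMoment volume 0 1 := by
  rw [intervalIntegrable_iff_integrableOn_Ioc_of_le zero_le_one]
  exact integrableOn_bernoulliMoment.mono_set Ioc_subset_Ioi_self

lemma intervalIntegrable_constIntegrandZero_sub :
    IntervalIntegrable (fun t => constIntegrandZero t - bernoulliMoment t) volume 0 1 := by
  rw [intervalIntegrable_iff_integrableOn_Ioc_of_le zero_le_one]
  refine Measure.integrableOn_of_bounded (M := 2) (by simp) ?_ ?_
  · unfold constIntegrandZero bernoulliMoment expMoment
    exact Measurable.aestronglyMeasurable (by fun_prop)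
  · exact (ae_restrict_iff' measurableSet_Ioc).2 (Eventually.of_forall fun t ht =>
      abs_constIntegrandZero_sub_bernoulliMoment_le ht.1)

lemma intervalIntegrable_constIntegrandZero :
    IntervalIntegrable constIntegrandZero volume 0 1 := by
  simpa using intervalIntegrable_constIntegrandZero_sub.add intervalIntegrable_bernoulliMoment

lemma integral_bernoulliMoment_eq_one_sub :
    ∫ t in Ioi (0 : ℝ), bernoulliMoment t = 1 - vasyuninC := by
  have h0 : ∫ t in (0 : ℝ)..1, (constIntegrandZero t - bernoulliMoment t) = boseLogReg 1 - 1 :=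
    intervalIntegral.integral_eq_sub_of_hasDerivAt_of_tendsto one_pos
      (fun t ht => hasDerivAt_boseLogReg ht.1) intervalIntegrable_constIntegrandZero_sub
      tendsto_boseLogReg
      (hasDerivAt_boseLogReg one_pos).continuousAt.continuousWithinAt.tendsto
  have hB : IntegrableOn bernoulliMoment (Ioi 1) :=
    integrableOn_bernoulliMoment.mono_set (Ioi_subset_Ioi zero_le_one)
  have h1 : ∫ t in Ioi (1 : ℝ), (constIntegrandInf t - bernoulliMoment t) = 0 - boseLog 1 :=
    integral_Ioi_of_hasDerivAt_of_tendsto'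
      (fun t (ht : 1 ≤ t) => hasDerivAt_boseLog (zero_lt_one.trans_le ht))
      (integrableOn_constIntegrandInf.sub hB) tendsto_boseLog_atTop
  rw [intervalIntegral.integral_sub intervalIntegrable_constIntegrandZero
    intervalIntegrable_bernoulliMoment] at h0
  rw [integral_sub integrableOn_constIntegrandInf hB] at h1
  have h2 := intervalIntegral.integral_interval_add_Ioi integrableOn_bernoulliMoment hB
  -- The extra 1 cancels the limit of `boseLogReg` at 0, and the values of `boseLog` at 1 cancel
  -- between the two intervals.
  have h3 : boseLogReg 1 = boseLog 1 + 1 := by simp [boseLogReg]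
  rw [vasyuninC, ← h2]
  linarith

lemma vasyuninC_eq :
    vasyuninC = 1 / 2 * (Real.log (2 * Real.pi) - Real.eulerMascheroniConstant) := by
  have h := integral_bernoulliMoment_eq_one_sub
  rw [integral_bernoulliMoment] at h
  linarith

/-- Dominated by 1 on (0, 1] and by 1/(mnt²) beyond. -/
lemma integrableOn_vasyuninE_mul {m n : ℕ} (hm : m ≠ 0) (hn : n ≠ 0) :
    IntegrableOn (fun t => vasyuninE m t * vasyuninE n t) (Ioi 0) := by
  have hm0 : (0 : ℝ) < m := Nat.cast_pos.2 (Nat.pos_of_ne_zero hm)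
  have hn0 : (0 : ℝ) < n := Nat.cast_pos.2 (Nat.pos_of_ne_zero hn)
  have hmeas : Measurable (fun t => vasyuninE m t * vasyuninE n t) := by
    unfold vasyuninE
    fun_prop
  have hnn : ∀ t, 0 < t → 0 ≤ vasyuninE m t * vasyuninE n t := fun t ht => by
    rw [vasyuninE_eq_comp m, vasyuninE_eq_comp n]
    exact mul_nonneg (vasyuninE_one_nonneg (by positivity)) (vasyuninE_one_nonneg (by positivity))
  rw [← Ioc_union_Ioi_eq_Ioi (zero_le_one' ℝ)]
  refine IntegrableOn.union ?_ ?_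
  · refine Measure.integrableOn_of_bounded (M := 1) (by simp) hmeas.aestronglyMeasurable ?_
    refine (ae_restrict_iff' measurableSet_Ioc).2 (Eventually.of_forall fun t ht => ?_)
    have ht := ht.1
    rw [Real.norm_of_nonneg (hnn t ht), vasyuninE_eq_comp m, vasyuninE_eq_comp n]
    exact mul_le_one₀ (vasyuninE_one_le_one (by positivity)) (vasyuninE_one_nonneg (by positivity))
      (vasyuninE_one_le_one (by positivity))
  · have h2 : IntegrableOn (fun t : ℝ => 1 / (m * n) * t ^ (-2 : ℝ)) (Ioi 1) :=
      (integrableOn_Ioi_rpow_of_lt (by norm_num) one_pos).const_mul _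
    refine h2.mono' hmeas.aestronglyMeasurable ?_
    refine (ae_restrict_iff' measurableSet_Ioi).2 (Eventually.of_forall fun t (ht : 1 < t) => ?_)
    have ht : 0 < t := by linarith
    rw [Real.norm_of_nonneg (hnn t ht), vasyuninE_eq_comp m, vasyuninE_eq_comp n]
    refine (mul_le_mul (vasyuninE_one_le_inv (by positivity)) (vasyuninE_one_le_inv (by positivity))
      (vasyuninE_one_nonneg (by positivity)) (by positivity)).trans (le_of_eq ?_)
    rw [Real.rpow_neg ht.le, Real.rpow_two]
    field_simp

/-! ### The non-oscillating part. -/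

/-- An antiderivative of the non-oscillating part of the product integrand. -/
def productPrimitive (m n : ℕ) (t : ℝ) : ℝ :=
  vasyuninE 1 t - 2 / t - (n * boseLog (n * t) + m * boseLog (m * t)
    + m / 2 * Real.log (1 - Real.exp (-(n * t))) + n / 2 * Real.log (1 - Real.exp (-(m * t))))

lemma hasDerivAt_productPrimitive {m n : ℕ} (hm : m ≠ 0) (hn : n ≠ 0) {t : ℝ} (ht : 0 < t) :
    HasDerivAt (productPrimitive m n)
      (Real.exp t / (Real.exp t - 1) ^ 2 + 1 / t ^ 2
        - (n / t + m * n / 2) * (1 / (Real.exp (n * t) - 1))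
        - (m / t + m * n / 2) * (1 / (Real.exp (m * t) - 1))
        + n * (n * bernoulliMoment (n * t)) + m * (m * bernoulliMoment (m * t))) t := by
  have hm0 : (0 : ℝ) < m := Nat.cast_pos.2 (Nat.pos_of_ne_zero hm)
  have hn0 : (0 : ℝ) < n := Nat.cast_pos.2 (Nat.pos_of_ne_zero hn)
  have hmt : 0 < m * t := by positivity
  have hnt : 0 < n * t := by positivity
  have e1 : Real.exp t - 1 ≠ 0 := (sub_pos.2 (Real.one_lt_exp_iff.2 ht)).ne'
  have e2 : Real.exp (m * t) - 1 ≠ 0 := (sub_pos.2 (Real.one_lt_exp_iff.2 hmt)).ne'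
  have e3 : Real.exp (n * t) - 1 ≠ 0 := (sub_pos.2 (Real.one_lt_exp_iff.2 hnt)).ne'
  have dm : HasDerivAt (fun t : ℝ => (m : ℝ) * t) m t := by
    simpa using (hasDerivAt_id t).const_mul (m : ℝ)
  have dn : HasDerivAt (fun t : ℝ => (n : ℝ) * t) n t := by
    simpa using (hasDerivAt_id t).const_mul (n : ℝ)
  have dE : HasDerivAt (vasyuninE 1)
      (-(1 / t ^ 2) + Real.exp t / (Real.exp t - 1) ^ 2) t := by
    have h := (hasDerivAt_inv ht.ne').sub (((Real.hasDerivAt_exp t).sub_const 1).inv e1)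
    convert! h using 1
    · ext x
      simp [vasyuninE]
    · ring
  have dt : HasDerivAt (fun t : ℝ => 2 / t) (2 * -(t ^ 2)⁻¹) t := by
    simpa [div_eq_mul_inv] using (hasDerivAt_inv ht.ne').const_mul 2
  have h := (dE.sub dt).sub ((((((hasDerivAt_boseLog hnt).comp t dn).const_mul (n : ℝ)).add
    (((hasDerivAt_boseLog hmt).comp t dm).const_mul (m : ℝ))).add
    (((hasDerivAt_log_one_sub_exp_neg hnt).comp t dn).const_mul ((m : ℝ) / 2))).add
    (((hasDerivAt_log_one_sub_exp_neg hmt).comp t dm).const_mul ((n : ℝ) / 2)))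
  convert! h using 1
  simp only [constIntegrandInf]
  field_simp
  ring

lemma tendsto_nat_mul_nhdsGT_zero {n : ℕ} (hn : n ≠ 0) :
    Tendsto (fun t : ℝ => (n : ℝ) * t) (𝓝[>] 0) (𝓝[>] 0) := by
  have hn0 : (0 : ℝ) < n := Nat.cast_pos.2 (Nat.pos_of_ne_zero hn)
  refine tendsto_nhdsWithin_iff.2 ⟨tendsto_nhdsWithin_of_tendsto_nhds
    (Continuous.tendsto' (by fun_prop) _ _ (by simp)), ?_⟩
  filter_upwards [self_mem_nhdsWithin] with t (ht : 0 < t)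
  exact mul_pos hn0 ht

/-- Passing from `boseLog` to `boseLogReg` cancels 2/t; the log t terms cancel as well and leave
only log(n/m). -/
lemma tendsto_productPrimitive_zero {m n : ℕ} (hm : m ≠ 0) (hn : n ≠ 0) :
    Tendsto (productPrimitive m n) (𝓝[>] 0)
      (𝓝 (1 / 2 - (n + m) - ((m : ℝ) - n) / 2 * Real.log ((n : ℝ) / m))) := by
  have hm0 : (0 : ℝ) < m := Nat.cast_pos.2 (Nat.pos_of_ne_zero hm)
  have hn0 : (0 : ℝ) < n := Nat.cast_pos.2 (Nat.pos_of_ne_zero hn)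
  have tm := tendsto_nat_mul_nhdsGT_zero hm
  have tn := tendsto_nat_mul_nhdsGT_zero hn
  have h := ((tendsto_vasyuninE_one.sub ((((tendsto_boseLogReg.comp tn).const_mul (n : ℝ)).add
    ((tendsto_boseLogReg.comp tm).const_mul (m : ℝ))).add
    (((tendsto_log_one_sub_exp_neg_div.comp tn).const_mul ((m : ℝ) / 2)).add
    ((tendsto_log_one_sub_exp_neg_div.comp tm).const_mul ((n : ℝ) / 2))))).sub_const
    (((m : ℝ) - n) / 2 * Real.log ((n : ℝ) / m)))
  simp only [mul_one, mul_zero, add_zero] at h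
  refine h.congr' ?_
  filter_upwards [self_mem_nhdsWithin] with t (ht : 0 < t)
  have hlog : ∀ x : ℝ, 0 < x → Real.log ((1 - Real.exp (-(x * t))) / (x * t)) =
      Real.log (1 - Real.exp (-(x * t))) - (Real.log x + Real.log t) := fun x hx => by
    rw [Real.log_div (sub_pos.2 (exp_neg_lt_one (mul_pos hx ht))).ne' (mul_pos hx ht).ne',
      Real.log_mul hx.ne' ht.ne']
  simp only [Function.comp, productPrimitive, boseLogReg]
  rw [hlog n hn0, hlog m hm0, Real.log_mul hn0.ne' ht.ne', Real.log_mul hm0.ne' ht.ne',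
    Real.log_div hn0.ne' hm0.ne']
  field_simp
  ring

lemma tendsto_productPrimitive_atTop {m n : ℕ} (hm : m ≠ 0) (hn : n ≠ 0) :
    Tendsto (productPrimitive m n) atTop (𝓝 0) := by
  have hm0 : (0 : ℝ) < m := Nat.cast_pos.2 (Nat.pos_of_ne_zero hm)
  have hn0 : (0 : ℝ) < n := Nat.cast_pos.2 (Nat.pos_of_ne_zero hn)
  have tm : Tendsto (fun t : ℝ => (m : ℝ) * t) atTop atTop := tendsto_id.const_mul_atTop hm0
  have tn : Tendsto (fun t : ℝ => (n : ℝ) * t) atTop atTop := tendsto_id.const_mul_atTop hn0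
  have hE : Tendsto (vasyuninE 1) atTop (𝓝 0) := by
    refine tendsto_of_tendsto_of_tendsto_of_le_of_le' tendsto_const_nhds tendsto_inv_atTop_zero
      ?_ ?_
    · filter_upwards [eventually_gt_atTop 0] with t ht using vasyuninE_one_nonneg ht
    · filter_upwards [eventually_gt_atTop 0] with t ht
      simpa using vasyuninE_one_le_inv ht
  have h2 : Tendsto (fun t : ℝ => 2 / t) atTop (𝓝 0) := tendsto_const_nhds.div_atTop tendsto_id
  have h := (hE.sub h2).sub (((((tendsto_boseLog_atTop.comp tn).const_mul (n : ℝ)).add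
    ((tendsto_boseLog_atTop.comp tm).const_mul (m : ℝ))).add
    ((tendsto_log_one_sub_exp_neg_atTop.comp tn).const_mul ((m : ℝ) / 2))).add
    ((tendsto_log_one_sub_exp_neg_atTop.comp tm).const_mul ((n : ℝ) / 2)))
  simp only [mul_zero, add_zero, sub_zero] at h
  exact h

/-! ### Cotangent sums and the oscillating part. -/

lemma cot_nat_mul_pi_sub (k : ℕ) (x : ℝ) : Real.cot (k * Real.pi - x) = -Real.cot x := by
  rw [Real.cot_eq_cos_div_sin, Real.cot_eq_cos_div_sin, Real.cos_nat_mul_pi_sub,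
    Real.sin_nat_mul_pi_sub]
  rcases neg_one_pow_eq_or ℝ k with h | h <;> rw [h] <;> ring

lemma cot_nat_mul_pi (k : ℕ) : Real.cot (k * Real.pi) = 0 := by
  rw [Real.cot_eq_cos_div_sin, Real.sin_nat_mul_pi, div_zero]

/-- The reflection k ↦ n - k changes the sign of each cotangent; poles and k = 0 count as 0. -/
lemma sum_cot_eq_zero (m n : ℕ) :
    ∑ k ∈ Finset.range n, Real.cot (m * k * Real.pi / n) = 0 := by
  rcases n with _ | n
  · simp
  have h0 : Real.cot ((m : ℝ) * (0 : ℕ) * Real.pi / (n + 1 : ℕ)) = 0 := by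
    simpa using cot_nat_mul_pi 0
  rw [Finset.sum_range_succ', h0, add_zero]
  have h := Finset.sum_range_reflect
    (fun k : ℕ => Real.cot ((m : ℝ) * (k + 1 : ℕ) * Real.pi / (n + 1 : ℕ))) n
  have h2 : ∀ k ∈ Finset.range n,
      Real.cot ((m : ℝ) * (n - 1 - k + 1 : ℕ) * Real.pi / (n + 1 : ℕ)) =
        -Real.cot ((m : ℝ) * (k + 1 : ℕ) * Real.pi / (n + 1 : ℕ)) := fun k hk => by
    have hk := Finset.mem_range.1 hk
    rw [← cot_nat_mul_pi_sub m, show n - 1 - k + 1 = n - k by omega, Nat.cast_sub hk.le]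
    congr 1
    push_cast
    field_simp
    ring
  rw [Finset.sum_congr rfl h2, Finset.sum_neg_distrib] at h
  exact self_eq_neg.1 h.symm

lemma integrableOn_cot_mul_sinKernel {m n k : ℕ} (hk : k < n) :
    IntegrableOn (fun t => Real.cot (m * k * Real.pi / n) * sinKernel (2 * (k * Real.pi / n)) t)
        (Ioi 0) ∧
      ∫ t in Ioi (0 : ℝ), Real.cot (m * k * Real.pi / n) * sinKernel (2 * (k * Real.pi / n)) t =
        Real.cot (m * k * Real.pi / n) * (Real.pi / 2 - k * Real.pi / n) := by
  -- At k = 0 the angle leaves (0, π), but the coefficient cot 0 is 0 by default.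
  rcases Nat.eq_zero_or_pos k with rfl | hk0
  · have h : Real.cot ((m : ℝ) * (0 : ℕ) * Real.pi / n) = 0 := by simpa using cot_nat_mul_pi 0
    simp only [h, zero_mul]
    simp
  · have hn0 : (0 : ℝ) < n := Nat.cast_pos.2 (hk0.trans hk)
    have hk0' : (0 : ℝ) < k := Nat.cast_pos.2 hk0
    have hφ : (k : ℝ) * Real.pi / n ∈ Ioo 0 Real.pi := by
      refine ⟨by positivity, ?_⟩
      rw [div_lt_iff₀ hn0, mul_comm]
      exact mul_lt_mul_of_pos_left (Nat.cast_lt.2 hk) Real.pi_pos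
    exact ⟨(integrableOn_sinKernel hφ).const_mul _, by
      rw [integral_const_mul, integral_sinKernel hφ]⟩

/-- The weighted cotangent sum. -/
def vasyuninSum (m n : ℕ) : ℝ :=
  ∑ k ∈ Finset.range n, (m : ℝ) * k / n * Real.cot (m * k * Real.pi / n)

/-- The oscillating part of the product integrand. -/
def cotKernelSum (m n : ℕ) (t : ℝ) : ℝ :=
  ∑ k ∈ Finset.range n, Real.cot (m * k * Real.pi / n) * sinKernel (2 * (k * Real.pi / n)) t

lemma integrableOn_cotKernelSum (m n : ℕ) : IntegrableOn (cotKernelSum m n) (Ioi 0) :=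
  integrable_finsetSum _ fun _ hk =>
    (integrableOn_cot_mul_sinKernel (Finset.mem_range.1 hk)).1

lemma integral_cotKernelSum (m n : ℕ) :
    m / 2 * ∫ t in Ioi (0 : ℝ), cotKernelSum m n t = -(Real.pi / 2) * vasyuninSum m n := by
  have h : ∫ t in Ioi (0 : ℝ), cotKernelSum m n t = ∑ k ∈ Finset.range n,
      Real.cot (m * k * Real.pi / n) * (Real.pi / 2 - k * Real.pi / n) := by
    rw [← Finset.sum_congr rfl fun k hk =>
      (integrableOn_cot_mul_sinKernel (m := m) (Finset.mem_range.1 hk)).2]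
    exact integral_finsetSum _ fun _ hk =>
      (integrableOn_cot_mul_sinKernel (Finset.mem_range.1 hk)).1
  simp only [h, mul_sub, Finset.sum_sub_distrib]
  rw [← Finset.sum_mul, sum_cot_eq_zero, vasyuninSum, Finset.mul_sum, Finset.mul_sum, zero_mul,
    mul_zero, zero_sub, ← Finset.sum_neg_distrib]
  exact Finset.sum_congr rfl fun k _ => by ring

/-! ### The formula for coprime m and n. -/

lemma vasyuninE_mul_eq {m n : ℕ} (hm : m ≠ 0) (hn : n ≠ 0) (hmn : m.Coprime n) {t : ℝ}
    (ht : 0 < t) :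
    Real.exp t / (Real.exp t - 1) ^ 2 + 1 / t ^ 2
        - (n / t + m * n / 2) * (1 / (Real.exp (n * t) - 1))
        - (m / t + m * n / 2) * (1 / (Real.exp (m * t) - 1))
        + n * (n * bernoulliMoment (n * t)) + m * (m * bernoulliMoment (m * t)) =
      m * n * (vasyuninE m t * vasyuninE n t) - m / 2 * cotKernelSum m n t
        - n / 2 * cotKernelSum n m t
        + n * (n * bernoulliMoment (n * t)) + m * (m * bernoulliMoment (m * t)) := by
  have hm0 : (m : ℝ) ≠ 0 := Nat.cast_ne_zero.2 hm
  have hn0 : (n : ℝ) ≠ 0 := Nat.cast_ne_zero.2 hn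
  have key := coth_mul_coth_eq hm hn hmn ht
  rw [← cotKernelSum, ← cotKernelSum] at key
  simp only [vasyuninE]
  generalize cotKernelSum m n t = A at *
  generalize cotKernelSum n m t = B at *
  generalize 1 / (Real.exp (m * t) - 1) = Em at *
  generalize 1 / (Real.exp (n * t) - 1) = En at *
  generalize Real.exp t / (Real.exp t - 1) ^ 2 = D at *
  have h : m * n * ((Em + 1 / 2) * (En + 1 / 2)) =
      m * n / 4 + D + m / 2 * A + n / 2 * B := by
    rw [key]
    field_simp
  have ht' := ht.ne'
  have e1 : (m : ℝ) * n * ((1 / (m * t) - Em) * (1 / (n * t) - En)) =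
      1 / t ^ 2 - n / t * En - m / t * Em + m * n * (Em * En) := by
    field_simp
    ring
  rw [e1]
  linear_combination -h

lemma integrableOn_comp_nat_mul {f : ℝ → ℝ} (hf : IntegrableOn f (Ioi 0)) {n : ℕ} (hn : n ≠ 0) :
    IntegrableOn (fun t => f (n * t)) (Ioi 0) := by
  have hn0 : (0 : ℝ) < n := Nat.cast_pos.2 (Nat.pos_of_ne_zero hn)
  rwa [integrableOn_Ioi_comp_mul_left_iff _ _ hn0, mul_zero]

lemma nat_mul_integral_comp_nat_mul (f : ℝ → ℝ) {n : ℕ} (hn : n ≠ 0) :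
    n * ∫ t in Ioi (0 : ℝ), f (n * t) = ∫ t in Ioi (0 : ℝ), f t := by
  have hn0 : (0 : ℝ) < n := Nat.cast_pos.2 (Nat.pos_of_ne_zero hn)
  rw [integral_comp_mul_left_Ioi _ _ hn0, mul_zero, smul_eq_mul, mul_inv_cancel_left₀ hn0.ne']

lemma integral_vasyuninE_mul_of_coprime {m n : ℕ} (hm : m ≠ 0) (hn : n ≠ 0)
    (hmn : m.Coprime n) :
    (m : ℝ) * n * ∫ t in Ioi (0 : ℝ), vasyuninE m t * vasyuninE n t =
      -(1 / 2) + vasyuninC * ((n : ℝ) + m) + ((m : ℝ) - n) / 2 * Real.log ((n : ℝ) / m)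
        - Real.pi / 2 * vasyuninSum m n - Real.pi / 2 * vasyuninSum n m := by
  have i1 := (integrableOn_vasyuninE_mul hm hn).const_mul ((m : ℝ) * n)
  have i2 := (integrableOn_cotKernelSum m n).const_mul ((m : ℝ) / 2)
  have i3 := (integrableOn_cotKernelSum n m).const_mul ((n : ℝ) / 2)
  have i4 := ((integrableOn_comp_nat_mul integrableOn_bernoulliMoment hn).const_mul
    (n : ℝ)).const_mul (n : ℝ)
  have i5 := ((integrableOn_comp_nat_mul integrableOn_bernoulliMoment hm).const_mul
    (m : ℝ)).const_mul (m : ℝ)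
  -- The two moments contribute (n + m)(1 - C), whose n + m cancels against the limit of the
  -- primitive at 0.
  have h := integral_Ioi_of_hasDerivAt_of_tendsto_nhdsGT
    (fun t (ht : 0 < t) => by
      simp only [Pi.add_apply, Pi.sub_apply]
      rw [← vasyuninE_mul_eq hm hn hmn ht]
      exact hasDerivAt_productPrimitive hm hn ht)
    ((((i1.sub i2).sub i3).add i4).add i5) (tendsto_productPrimitive_zero hm hn)
    (tendsto_productPrimitive_atTop hm hn)
  rw [integral_add' (((i1.sub i2).sub i3).add i4) i5, integral_add' ((i1.sub i2).sub i3) i4,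
    integral_sub' (i1.sub i2) i3, integral_sub' i1 i2] at h
  simp only [integral_const_mul] at h
  rw [nat_mul_integral_comp_nat_mul bernoulliMoment hn,
    nat_mul_integral_comp_nat_mul bernoulliMoment hm, integral_cotKernelSum,
    integral_cotKernelSum, integral_bernoulliMoment_eq_one_sub] at h
  linarith

/-! ### Common factors. -/

lemma cot_nat_mul_pi_add (k : ℕ) (x : ℝ) : Real.cot (k * Real.pi + x) = Real.cot x := by
  have h := cot_nat_mul_pi_sub k (-x)
  have h2 := cot_nat_mul_pi_sub 0 x
  rw [Nat.cast_zero, zero_mul, zero_sub] at h2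
  rwa [sub_neg_eq_add, h2, neg_neg] at h

/-- Cut the range into g blocks of length n. A shift by jn preserves the cotangent and adds mj to
its weight, which contributes nothing as the cotangents sum to zero. -/
lemma vasyuninSum_mul_mul {g n : ℕ} (m : ℕ) (hg : g ≠ 0) (hn : n ≠ 0) :
    vasyuninSum (g * m) (g * n) = g * vasyuninSum m n := by
  have hg0 : (g : ℝ) ≠ 0 := Nat.cast_ne_zero.2 hg
  have hn0 : (n : ℝ) ≠ 0 := Nat.cast_ne_zero.2 hn
  have h1 : vasyuninSum (g * m) (g * n) = ∑ k ∈ Finset.range (g * n),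
      (m : ℝ) * k / n * Real.cot (m * k * Real.pi / n) := by
    refine Finset.sum_congr rfl fun k _ => ?_
    push_cast
    congr 1
    · field_simp
    · congr 1
      field_simp
  have h2 : ∀ j : ℕ, ∑ k ∈ Finset.range (j * n),
      (m : ℝ) * k / n * Real.cot (m * k * Real.pi / n) = j * vasyuninSum m n := fun j => by
    induction j with
    | zero => simp
    | succ j ih =>
      have h3 : ∀ r : ℕ, (m : ℝ) * (j * n + r : ℕ) / n *
          Real.cot (m * (j * n + r : ℕ) * Real.pi / n) =
          m * j * Real.cot (m * r * Real.pi / n) +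
            (m : ℝ) * r / n * Real.cot (m * r * Real.pi / n) := fun r => by
        rw [← cot_nat_mul_pi_add (m * j) (m * r * Real.pi / n), ← add_mul]
        push_cast
        congr 1
        · field_simp
        · congr 1
          field_simp
      rw [add_mul, one_mul, Finset.sum_range_add, ih, Finset.sum_congr rfl fun r _ => h3 r,
        Finset.sum_add_distrib, ← Finset.mul_sum, sum_cot_eq_zero, ← vasyuninSum]
      push_cast
      ring
  rw [h1, h2]

lemma integral_vasyuninE_mul {g m n : ℕ} (hg : g ≠ 0) (hm : m ≠ 0) (hn : n ≠ 0)
    (hmn : m.Coprime n) :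
    ((g * m : ℕ) : ℝ) * (g * n : ℕ) *
        ∫ t in Ioi (0 : ℝ), vasyuninE (g * m) t * vasyuninE (g * n) t =
      -(g / 2) + vasyuninC * (((g * n : ℕ) : ℝ) + (g * m : ℕ))
        + (((g * m : ℕ) : ℝ) - (g * n : ℕ)) / 2 * Real.log (((g * n : ℕ) : ℝ) / (g * m : ℕ))
        - Real.pi / 2 * vasyuninSum (g * m) (g * n)
        - Real.pi / 2 * vasyuninSum (g * n) (g * m) := by
  have hg0 : (g : ℝ) ≠ 0 := Nat.cast_ne_zero.2 hg
  have h1 : ∀ (p : ℕ) (t : ℝ), vasyuninE (g * p) t = vasyuninE p (g * t) := fun p t => by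
    rw [vasyuninE_eq_comp, vasyuninE_eq_comp p, Nat.cast_mul]
    congr 1
    ring
  have h2 := nat_mul_integral_comp_nat_mul (fun t => vasyuninE m t * vasyuninE n t) hg
  have h3 := integral_vasyuninE_mul_of_coprime hm hn hmn
  simp only [h1]
  rw [vasyuninSum_mul_mul m hg hn, vasyuninSum_mul_mul n hg hm]
  rw [← h2] at h3
  push_cast
  rw [mul_div_mul_left _ _ hg0]
  linear_combination (g : ℝ) * h3

/-- By coprimality the cotangent is undefined exactly at k = ns, where `vasyuninSum` counts 0; these
terms form the correction. -/
lemma sum_Ico_mul_eq {g m n : ℕ} (hg : g ≠ 0) (hn : n ≠ 0) (hmn : m.Coprime n) {c : ℕ → ℝ}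
    (hc : ∀ k ∈ Finset.Ico 1 (g * n), ¬ g * n ∣ g * m * k →
      c k = Real.cot (((g * m : ℕ) : ℝ) * k * Real.pi / (g * n : ℕ))) :
    ∑ k ∈ Finset.Ico 1 (g * n), ((g * m : ℕ) : ℝ) * k / (g * n : ℕ) * c k =
      vasyuninSum (g * m) (g * n) + ∑ s ∈ Finset.Ico 1 g, (m : ℝ) * s * c (n * s) := by
  have hg0 : (g : ℝ) ≠ 0 := Nat.cast_ne_zero.2 hg
  have hn0 : (n : ℝ) ≠ 0 := Nat.cast_ne_zero.2 hn
  have hV : vasyuninSum (g * m) (g * n) = ∑ k ∈ Finset.Ico 1 (g * n),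
      ((g * m : ℕ) : ℝ) * k / (g * n : ℕ) *
        Real.cot (((g * m : ℕ) : ℝ) * k * Real.pi / (g * n : ℕ)) := by
    rw [vasyuninSum, Finset.range_eq_Ico,
      Finset.sum_eq_sum_Ico_succ_bot (Nat.pos_of_ne_zero (mul_ne_zero hg hn))]
    simp
  rw [hV, ← sub_eq_iff_eq_add', ← Finset.sum_sub_distrib]
  symm
  refine Finset.sum_of_injOn (fun s => n * s)
    (fun a _ b _ h => Nat.eq_of_mul_eq_mul_left (Nat.pos_of_ne_zero hn) h) ?_ ?_ ?_
  · intro s hs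
    rw [Finset.mem_coe, Finset.mem_Ico] at hs ⊢
    refine ⟨Nat.mul_pos (Nat.pos_of_ne_zero hn) hs.1, ?_⟩
    rw [mul_comm g n]
    exact Nat.mul_lt_mul_of_pos_left hs.2 (Nat.pos_of_ne_zero hn)
  · intro k hk hk'
    rw [hc k hk, sub_self]
    intro hdvd
    rw [mul_assoc] at hdvd
    obtain ⟨s, rfl⟩ := hmn.symm.dvd_of_dvd_mul_left
      (Nat.dvd_of_mul_dvd_mul_left (Nat.pos_of_ne_zero hg) hdvd)
    rw [Finset.mem_Ico, mul_comm g n] at hk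
    refine hk' ⟨s, Finset.mem_coe.2 (Finset.mem_Ico.2 ⟨Nat.pos_of_ne_zero ?_, ?_⟩), rfl⟩
    · rintro rfl
      simp at hk
    · exact Nat.lt_of_mul_lt_mul_left hk.2
  · intro s _
    have h1 : ((g * m : ℕ) : ℝ) * (n * s : ℕ) / (g * n : ℕ) = m * s := by
      push_cast
      field_simp
    have h2 : ((g * m : ℕ) : ℝ) * (n * s : ℕ) * Real.pi / (g * n : ℕ) = (m * s : ℕ) * Real.pi := by
      rw [mul_div_right_comm, h1, Nat.cast_mul]
    simp only [h1, h2, cot_nat_mul_pi, mul_zero, sub_zero]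

/-! ### The limiting value and the convention. -/

lemma tendsto_cot_sub_inv : Tendsto (fun y : ℝ => Real.cot y - 1 / y) (𝓝[≠] 0) (𝓝 0) := by
  have h1 : Tendsto (fun y : ℝ => Real.sin y / y) (𝓝[≠] 0) (𝓝 1) := by
    have h := (Real.hasDerivAt_sin 0).tendsto_slope_zero
    simp only [zero_add, Real.sin_zero, sub_zero, smul_eq_mul, Real.cos_zero] at h
    exact h.congr fun t => by rw [div_eq_inv_mul]
  have h2 : Tendsto (fun y : ℝ => (y * Real.cos y - Real.sin y) / y ^ 2) (𝓝[≠] 0) (𝓝 0) := by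
    refine HasDerivAt.lhopital_zero_nhdsNE (f' := fun y => -(y * Real.sin y))
      (g' := fun y => 2 * y) ?_ ?_ ?_ ?_ ?_ ?_
    · refine Eventually.of_forall fun y => ?_
      have h := ((hasDerivAt_id y).mul (Real.hasDerivAt_cos y)).sub (Real.hasDerivAt_sin y)
      convert! h using 1
      simp
    · exact Eventually.of_forall fun t => by simpa using hasDerivAt_pow 2 t
    · filter_upwards [self_mem_nhdsWithin] with y hy using mul_ne_zero two_ne_zero hy
    · refine tendsto_nhdsWithin_of_tendsto_nhds (Continuous.tendsto' ?_ _ _ ?_)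
      · fun_prop
      · simp
    · refine tendsto_nhdsWithin_of_tendsto_nhds (Continuous.tendsto' ?_ _ _ ?_)
      · fun_prop
      · simp
    · have h : Tendsto (fun y : ℝ => -(Real.sin y / 2)) (𝓝[≠] 0) (𝓝 0) :=
        tendsto_nhdsWithin_of_tendsto_nhds
          (Continuous.tendsto' (by fun_prop) _ _ (by simp))
      refine h.congr' ?_
      filter_upwards [self_mem_nhdsWithin] with y hy
      have hy : y ≠ 0 := hy
      field_simp
  have h3 := h2.div h1 one_ne_zero
  rw [zero_div] at h3
  refine h3.congr' ?_
  filter_upwards [self_mem_nhdsWithin, h1.eventually_ne one_ne_zero] with y hy hs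
  have hy : y ≠ 0 := hy
  have hs : Real.sin y ≠ 0 := fun h => hs (by rw [h, zero_div])
  simp only [Pi.div_apply, Real.cot_eq_cos_div_sin]
  field_simp

/-- With u = π(xk - l), the cotangents are cot u and -cot(u/x). Their principal parts contribute
(xkπ - lπ)/u = 1, and the remainders tend to 0. -/
lemma tendsto_cot_add_cot {k l : ℕ} (hk : k ≠ 0) (hl : l ≠ 0) :
    Tendsto (fun x : ℝ =>
        Real.cot (x * k * Real.pi) * (x * k * Real.pi) +
          Real.cot (1 / x * l * Real.pi) * (1 / x * l * Real.pi))
      (𝓝[≠] ((l : ℝ) / k)) (𝓝 1) := by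
  have hk0 : (k : ℝ) ≠ 0 := Nat.cast_ne_zero.2 hk
  have hl0 : (l : ℝ) ≠ 0 := Nat.cast_ne_zero.2 hl
  have hx0 : (l : ℝ) / k ≠ 0 := div_ne_zero hl0 hk0
  have hpi := Real.pi_ne_zero
  have hev : ∀ᶠ x : ℝ in 𝓝[≠] ((l : ℝ) / k), x ≠ 0 :=
    (eventually_ne_nhds hx0).filter_mono nhdsWithin_le_nhds
  have hne : ∀ᶠ x : ℝ in 𝓝[≠] ((l : ℝ) / k), x * k - l ≠ 0 := by
    filter_upwards [self_mem_nhdsWithin] with x hx h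
    exact hx ((eq_div_iff hk0).2 (sub_eq_zero.1 h))
  have t1 : Tendsto (fun x : ℝ => Real.pi * (x * k - l)) (𝓝[≠] ((l : ℝ) / k)) (𝓝[≠] 0) := by
    refine tendsto_nhdsWithin_iff.2 ⟨tendsto_nhdsWithin_of_tendsto_nhds
      (Continuous.tendsto' (by fun_prop) _ _ ?_), ?_⟩
    · field_simp
      simp
    · filter_upwards [hne] with x hx using mul_ne_zero hpi hx
  have t2 : Tendsto (fun x : ℝ => Real.pi * (x * k - l) / x) (𝓝[≠] ((l : ℝ) / k)) (𝓝[≠] 0) := by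
    refine tendsto_nhdsWithin_iff.2 ⟨?_, ?_⟩
    · have h := (t1.mono_right nhdsWithin_le_nhds).div
        (tendsto_nhdsWithin_of_tendsto_nhds tendsto_id : Tendsto id (𝓝[≠] ((l : ℝ) / k)) _) hx0
      rwa [zero_div] at h
    · filter_upwards [hne, hev] with x hx hx' using div_ne_zero (mul_ne_zero hpi hx) hx'
  have c1 : Tendsto (fun x : ℝ => x * k * Real.pi) (𝓝[≠] ((l : ℝ) / k))
      (𝓝 ((l : ℝ) / k * k * Real.pi)) :=
    tendsto_nhdsWithin_of_tendsto_nhds (Continuous.tendsto (by fun_prop) _)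
  have c2 : Tendsto (fun x : ℝ => 1 / x * l * Real.pi) (𝓝[≠] ((l : ℝ) / k))
      (𝓝 (1 / ((l : ℝ) / k) * l * Real.pi)) :=
    tendsto_nhdsWithin_of_tendsto_nhds
      (ContinuousAt.tendsto (f := fun x : ℝ => 1 / x * l * Real.pi)
        (by fun_prop (disch := exact hx0)))
  have h := ((c1.mul (tendsto_cot_sub_inv.comp t1)).const_add 1).sub
    (c2.mul (tendsto_cot_sub_inv.comp t2))
  rw [mul_zero, mul_zero, sub_zero, add_zero] at h
  refine h.congr' ?_
  filter_upwards [hne, hev] with x hx hx'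
  have e1 : Real.cot (x * k * Real.pi) = Real.cot (Real.pi * (x * k - l)) := by
    rw [← cot_nat_mul_pi_add l (Real.pi * (x * k - l))]
    congr 1
    ring
  have e2 : Real.cot (1 / x * l * Real.pi) = -Real.cot (Real.pi * (x * k - l) / x) := by
    rw [← cot_nat_mul_pi_sub k]
    congr 1
    field_simp
    ring
  simp only [Function.comp]
  rw [e1, e2]
  generalize Real.cot (Real.pi * (x * k - l)) = A
  generalize Real.cot (Real.pi * (x * k - l) / x) = B
  field_simp
  ring

lemma exists_isCotConvention {m n : ℕ} (hm : m ≠ 0) (hn : n ≠ 0) :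
    ∃ c d : ℕ → ℝ, IsCotConvention m n c d := by
  classical
  have hm0 : (m : ℝ) ≠ 0 := Nat.cast_ne_zero.2 hm
  have hn0 : (n : ℝ) ≠ 0 := Nat.cast_ne_zero.2 hn
  -- All the weight goes to c, the reciprocal of the argument at a pole; d keeps the default 0, so
  -- each pair gives 1 + 0.
  refine ⟨fun k => if n ∣ m * k then ((m : ℝ) * k * Real.pi / n)⁻¹ else
    Real.cot ((m : ℝ) * k * Real.pi / n), fun l => Real.cot ((n : ℝ) * l * Real.pi / m),
    fun k _ h => if_neg h, fun l _ _ => rfl, fun k hk l hl h => ?_⟩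
  have hk0 : k ≠ 0 := (Nat.lt_of_lt_of_le one_pos (Finset.mem_Ico.1 hk).1).ne'
  have hl0 : (l : ℝ) ≠ 0 := Nat.cast_ne_zero.2
    (Nat.lt_of_lt_of_le one_pos (Finset.mem_Ico.1 hl).1).ne'
  have hk0' : (k : ℝ) ≠ 0 := Nat.cast_ne_zero.2 hk0
  rw [div_eq_div_iff hl0 hm0] at h
  have hdvd : n ∣ m * k := ⟨l, by exact_mod_cast (mul_comm _ _).trans h⟩
  have e : (n : ℝ) * l * Real.pi / m = k * Real.pi := by
    rw [← h]
    field_simp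
  simp only [if_pos hdvd, e, cot_nat_mul_pi, zero_mul, add_zero]
  have := Real.pi_ne_zero
  exact inv_mul_cancel₀ (by positivity)

/-- The indices ns and ms form a pair of the convention for each s from 1 to g - 1, and each pair
contributes 1. -/
lemma sum_pair_eq {g m n : ℕ} (hg : g ≠ 0) (hm : m ≠ 0) (hn : n ≠ 0) {c d : ℕ → ℝ}
    (h : IsCotConvention (g * m) (g * n) c d) :
    Real.pi * (∑ s ∈ Finset.Ico 1 g, (m : ℝ) * s * c (n * s)
      + ∑ s ∈ Finset.Ico 1 g, (n : ℝ) * s * d (m * s)) = g - 1 := by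
  have hg0 : (g : ℝ) ≠ 0 := Nat.cast_ne_zero.2 hg
  have hm0 : (m : ℝ) ≠ 0 := Nat.cast_ne_zero.2 hm
  have hn0 : (n : ℝ) ≠ 0 := Nat.cast_ne_zero.2 hn
  have hmem : ∀ p : ℕ, p ≠ 0 → ∀ s ∈ Finset.Ico 1 g, p * s ∈ Finset.Ico 1 (g * p) :=
    fun p hp s hs => by
      rw [Finset.mem_Ico] at hs ⊢
      refine ⟨Nat.mul_pos (Nat.pos_of_ne_zero hp) hs.1, ?_⟩
      rw [mul_comm g p]
      exact Nat.mul_lt_mul_of_pos_left hs.2 (Nat.pos_of_ne_zero hp)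
  have hone : ∀ s ∈ Finset.Ico 1 g,
      Real.pi * ((m : ℝ) * s * c (n * s) + (n : ℝ) * s * d (m * s)) = 1 := fun s hs => by
    have hs0 : (s : ℝ) ≠ 0 := Nat.cast_ne_zero.2
      (Nat.lt_of_lt_of_le one_pos (Finset.mem_Ico.1 hs).1).ne'
    have hp := h.pair_eq (n * s) (hmem n hn s hs) (m * s) (hmem m hm s hs) (by
      push_cast
      field_simp)
    rw [← hp]
    push_cast
    field_simp
  rw [← Finset.sum_add_distrib, Finset.mul_sum, Finset.sum_congr rfl hone, Finset.sum_const,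
    Nat.card_Ico, nsmul_eq_mul, mul_one, Nat.cast_sub (Nat.pos_of_ne_zero hg), Nat.cast_one]

end

theorem mainTheorem3 (m n : ℕ) (hm : 1 ≤ m) (hn : 1 ≤ n) :
    -- the constant `C`
    (IntervalIntegrable constIntegrandZero volume 0 1 ∧
      IntegrableOn constIntegrandInf (Ioi 1) ∧
      vasyuninC = 1 / 2 * (Real.log (2 * Real.pi) - Real.eulerMascheroniConstant)) ∧
    -- the value `1` in the convention is the limiting value
    (∀ k ∈ Finset.Ico 1 n, ∀ l ∈ Finset.Ico 1 m, (k : ℝ) / l = (n : ℝ) / m →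
      Tendsto (fun x : ℝ =>
          Real.cot (x * k * Real.pi) * (x * k * Real.pi) +
            Real.cot (1 / x * l * Real.pi) * (1 / x * l * Real.pi))
        (𝓝[≠] ((m : ℝ) / n)) (𝓝 1)) ∧
    -- the convention can be met
    (∃ c d : ℕ → ℝ, IsCotConvention m n c d) ∧
    -- the general Vasyunin-type formula
    IntegrableOn (fun t => vasyuninE m t * vasyuninE n t) (Ioi 0) ∧
    ∀ c d : ℕ → ℝ, IsCotConvention m n c d →
      (m : ℝ) * n * ∫ t in Ioi (0 : ℝ), vasyuninE m t * vasyuninE n t =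
        -(1 / 2) + vasyuninC * ((n : ℝ) + m)
          + ((m : ℝ) - n) / 2 * Real.log ((n : ℝ) / m)
          - Real.pi / 2 * ∑ k ∈ Finset.Ico 1 n, (m : ℝ) * k / n * c k
          - Real.pi / 2 * ∑ l ∈ Finset.Ico 1 m, (n : ℝ) * l / m * d l := by
  have hm0 : m ≠ 0 := Nat.pos_iff_ne_zero.1 hm
  have hn0 : n ≠ 0 := Nat.pos_iff_ne_zero.1 hn
  refine ⟨⟨intervalIntegrable_constIntegrandZero, integrableOn_constIntegrandInf, vasyuninC_eq⟩,
    fun k hk l hl h => ?_, exists_isCotConvention hm0 hn0, integrableOn_vasyuninE_mul hm0 hn0,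
    fun c d h => ?_⟩
  · have hk0 : k ≠ 0 := (Nat.lt_of_lt_of_le one_pos (Finset.mem_Ico.1 hk).1).ne'
    have hl0 : l ≠ 0 := (Nat.lt_of_lt_of_le one_pos (Finset.mem_Ico.1 hl).1).ne'
    have hx : (m : ℝ) / n = (l : ℝ) / k := by
      rw [← inv_div, ← h, inv_div]
    rw [hx]
    exact tendsto_cot_add_cot hk0 hl0
  · obtain ⟨g, m', n', hg, hcop, rfl, rfl⟩ := Nat.exists_coprime' (Nat.gcd_pos_of_pos_left n hm)
    rw [mul_comm m' g, mul_comm n' g] at *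
    have hg0 : g ≠ 0 := hg.ne'
    have hm' : m' ≠ 0 := right_ne_zero_of_mul hm0
    have hn' : n' ≠ 0 := right_ne_zero_of_mul hn0
    rw [integral_vasyuninE_mul hg0 hm' hn' hcop, sum_Ico_mul_eq hg0 hn' hcop h.left_eq,
      sum_Ico_mul_eq hg0 hm' hcop.symm h.right_eq]
    -- Half of g - 1 is the gap between -1/2 and -g/2.
    linear_combination (1 / 2) * sum_pair_eq hg0 hm' hn' h
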